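/- Let $G$ and $H$ be (finite-dimensional, real) Lie groups with Lie algebras $\mathfrak g,\mathfrak h$, let $K\subset G$ be a closed Lie subgroup with Lie algebra $\mathfrak k$, and let $\lambda:K\to H$ be a Lie group homomorphism with derivative $\lambda_*:\mathfrak k\to\mathfrak h$. Let $P_\lambda=G\times_\lambda H$ be the quotient of $G\times H$ by $(g,h)\sim(gk,\lambda(k)^{-1}h)$, $k\in K$, with the left $G$-action $g\cdot[g',h]=[gg',h]$ and the right $H$-action $[g,h']\cdot h=[g,h'h]$. It carries a smooth structure for which $G\times H\to P_\lambda$ is a submersion, and we use this (unique) structure. A connection on $P_\lambda$ is a smooth $\mathfrak h$-valued $1$-form $\omega$ with $R_h^*\omega=\mathrm{Ad}_{h^{-1}}\omega$ for all $h\in H$ and $\omega(y^*)=y$ for all $y\in\mathfrak h$, where $y^*$ is the fundamental vertical field of $y$; it is $G$-invariant if $L_g^*\omega=\omega$ for all $g\in G$. A Wang map is a linear map $W:\mathfrak g\to\mathfrak h$ with $W|_{\mathfrak k}=\lambda_*$ and $W\circ\mathrm{Ad}_k=\mathrm{Ad}_{\lambda(k)}\circ W$ for all $k\in K$; a $G$-invariant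 connection $\omega$ is associated to $W$ if $\omega_p(x^*_p)=W(x)$ for all $x\in\mathfrak g$, where $p=[e,e]$ and $x^*_p=\frac{d}{dt}\big|_{t=0}\exp(tx)\cdot p$. (1) Suppose that $G/K$ is $\lambda$-reductive with decomposition $\mathfrak g=\mathfrak k\oplus\mathfrak s$, i.e. $\mathfrak s\subset\mathfrak g$ is a vector subspace with $\mathfrak g=\mathfrak k\oplus\mathfrak s$ and $\mathrm{Ad}_k(\mathfrak s)\subset\ker(\lambda_*)\oplus\mathfrak s$ for all $k\in K$. Then the unique linear map $W_\lambda:\mathfrak g\to\mathfrak h$ equal to $\lambda_*$ on $\mathfrak k$ and to $0$ on $\mathfrak s$ is a Wang map, and there is exactly one $G$-invariant connection on $P_\lambda$ associated to $W_\lambda$ (the canonical connection). (2) Suppose that $\mathfrak g=\mathfrak k\oplus\mathfrak s$ is a reductive decomposition, i.e. moreover $\mathrm{Ad}_k(\mathfrak s)\subset\mathfrak s$ for all $k\in K$. Then $G/K$ is $\lambda$-reductive with the same decomposition, and the connection of (1) is the usual canonical connection: the form $\theta=\mathrm{proj}_{\mathfrak k}\circ\Theta_G$ on $G$, where $\Theta_G$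 is the left-invariant Maurer--Cartan form and $\mathrm{proj}_{\mathfrak k}$ is the projection along $\mathfrak s$, is a $G$-invariant connection on the principal $K$-bundle $G\to G/K$, and the connection of (1) is the one that $\theta$ induces on $P_\lambda$ via $f:G\to P_\lambda$, $f(g)=[g,e]$, i.e. the unique connection $\omega$ on $P_\lambda$ with $f^*\omega=\lambda_*\circ\theta$. -/

import Mathlib

open scoped Manifold ContDiff

noncomputable section

namespace HomogeneousBundle

section LieGroups

variable {E : Type*} [NormedAddCommGroup E] [NormedSpace ℝ E]
  {G : Type*} [TopologicalSpace G] [ChartedSpace E G] [Group G]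

/-- The adjoint representation: `Ad g` is the derivative at `1` of `x ↦ g * x * g⁻¹`. -/
def Ad (g : G) : GroupLieAlgebra 𝓘(ℝ, E) G →L[ℝ] GroupLieAlgebra 𝓘(ℝ, E) G :=
  (mfderiv 𝓘(ℝ, E) 𝓘(ℝ, E) (fun x : G => g * x * g⁻¹) 1 : E →L[ℝ] E)

variable {E' : Type*} [NormedAddCommGroup E'] [NormedSpace ℝ E']
  {H : Type*} [TopologicalSpace H] [ChartedSpace E' H] [Group H]

/-- The map of Lie algebras `f_* : 𝔤 → 𝔥` of a homomorphism `f : G → H`: its derivative at `1`. -/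
def lieMap (f : G →* H) : GroupLieAlgebra 𝓘(ℝ, E) G →L[ℝ] GroupLieAlgebra 𝓘(ℝ, E') H :=
  (mfderiv 𝓘(ℝ, E) 𝓘(ℝ, E') (f : G → H) 1 : E →L[ℝ] E')

end LieGroups

section Connections

variable {EP : Type*} [NormedAddCommGroup EP] [NormedSpace ℝ EP]
  {P : Type*} [TopologicalSpace P] [ChartedSpace EP P]
  {EH : Type*} [NormedAddCommGroup EH] [NormedSpace ℝ EH]
  {H : Type*} [TopologicalSpace H] [ChartedSpace EH H] [Group H]

variable (EP P EH H) in
/-- Fibrewise linear `𝔥`-valued `1`-forms on `P` (no smoothness yet). -/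
abbrev LieForm : Type _ :=
  ∀ p : P, TangentSpace 𝓘(ℝ, EP) p →L[ℝ] GroupLieAlgebra 𝓘(ℝ, EH) H

/-- `η` is a (principal) connection form on `P`, where the structure group `H` acts on `P` from the
right by `act p h = p · h`. The form is smooth iff `(p, v) ↦ η_p v` is smooth on the tangent bundle,
and the value at `p` of the fundamental vector field `y*` is the image of `y` under the derivative
at `1` of `h ↦ p · h` (a vector at `p · 1 = p`). -/
structure IsConnection [IsManifold 𝓘(ℝ, EP) ∞ P] (act : P → H → P) (η : LieForm EP P EH H) : Prop where
  smooth : ContMDiff (M' := EH) 𝓘(ℝ, EP).tangent 𝓘(ℝ, EH) ∞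
    (fun v : TangentBundle 𝓘(ℝ, EP) P => η v.proj v.snd)
  equivariant : ∀ (h : H) (p : P) (v : TangentSpace 𝓘(ℝ, EP) p),
    η (act p h) (mfderiv 𝓘(ℝ, EP) 𝓘(ℝ, EP) (fun x => act x h) p v) = Ad h⁻¹ (η p v)
  fundamental : ∀ (p : P) (y : GroupLieAlgebra 𝓘(ℝ, EH) H),
    η (act p 1) (mfderiv 𝓘(ℝ, EH) 𝓘(ℝ, EP) (fun h => act p h) 1 y) = y

/-- `L_g^* η = η` for all `g : G`, where `G` acts on `P` from the left by `left g`. -/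
def IsInvariant {G : Type*} (left : G → P → P) (η : LieForm EP P EH H) : Prop :=
  ∀ (g : G) (p : P) (v : TangentSpace 𝓘(ℝ, EP) p),
    η (left g p) (mfderiv 𝓘(ℝ, EP) 𝓘(ℝ, EP) (left g) p v) = η p v

end Connections

section Bundle

variable {G : Type*} [Group G] {K : Subgroup G} {H : Type*} [Group H]

/-- The equivalence relation `(g, h) ∼ (g k, lam(k)⁻¹ h)`, `k ∈ K`, on `G × H`. -/
def bundleSetoid (lam : K →* H) : Setoid (G × H) where
  r a b := ∃ k : K, b = (a.1 * (k : G), (lam k)⁻¹ * a.2)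
  iseqv :=
    { refl := fun a => ⟨1, by simp⟩
      symm := by
        rintro a b ⟨k, rfl⟩
        exact ⟨k⁻¹, by simp⟩
      trans := by
        rintro a b c ⟨k, rfl⟩ ⟨l, rfl⟩
        exact ⟨k * l, by simp [mul_assoc]⟩ }

/-- The total space `P_lam = G ×_lam H` of the homogeneous principal `H`-bundle over `G ⧸ K`. -/
def Bundle (lam : K →* H) : Type _ := Quotient (bundleSetoid lam)

/-- `P_lam` carries the quotient topology. -/
instance (lam : K →* H) [TopologicalSpace G] [TopologicalSpace H] : TopologicalSpace (Bundle lam) :=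
  inferInstanceAs (TopologicalSpace (Quotient (bundleSetoid lam)))

/-- The class `[g, h]` of `(g, h)`. -/
def Bundle.mk (lam : K →* H) (a : G × H) : Bundle lam := Quotient.mk (bundleSetoid lam) a

/-- The bundle projection `P_lam → G ⧸ K`, `[g, h] ↦ g K`. -/
def Bundle.proj (lam : K →* H) : Bundle lam → G ⧸ K :=
  Quotient.lift (fun a : G × H => (a.1 : G ⧸ K)) (by
    rintro a b ⟨k, rfl⟩
    simp)

/-- The right action of `H` on `P_lam`: `[g, h'] · h = [g, h' h]`. -/
def Bundle.right (lam : K →* H) (p : Bundle lam) (h : H) : Bundle lam :=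
  Quotient.map (fun a : G × H => (a.1, a.2 * h)) (by
    rintro a b ⟨k, rfl⟩
    exact ⟨k, by simp [mul_assoc]⟩) p

/-- The left action of `G` on `P_lam`: `g · [g', h] = [g g', h]`. -/
def Bundle.left (lam : K →* H) (g : G) (p : Bundle lam) : Bundle lam :=
  Quotient.map (fun a : G × H => (g * a.1, a.2)) (by
    rintro a b ⟨k, rfl⟩
    exact ⟨k, by simp [mul_assoc]⟩) p

/-- The fibres of `P_lam → G ⧸ K` are the orbits of `H`, and `H` acts freely. -/
theorem Bundle.proj_eq_iff (lam : K →* H) (p q : Bundle lam) :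
    Bundle.proj lam p = Bundle.proj lam q ↔ ∃! h : H, Bundle.right lam p h = q := by
  induction p using Quotient.inductionOn with | _ a => ?_
  induction q using Quotient.inductionOn with | _ b => ?_
  constructor
  · intro hp
    have h1 : a.1⁻¹ * b.1 ∈ K := QuotientGroup.eq.1 hp
    refine ⟨a.2⁻¹ * lam ⟨_, h1⟩ * b.2, ?_, ?_⟩
    · exact Quotient.sound ⟨⟨_, h1⟩, by ext <;> simp [mul_assoc]⟩
    · intro h hh
      obtain ⟨k, hk⟩ := Quotient.exact hh
      have h2 : b.1 = a.1 * k := congrArg Prod.fst hk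
      have h3 : b.2 = (lam k)⁻¹ * (a.2 * h) := congrArg Prod.snd hk
      have h4 : (⟨_, h1⟩ : K) = k := by ext; simp [h2]
      rw [h4, h3]; simp [mul_assoc]
  · rintro ⟨h, hh, -⟩
    obtain ⟨k, hk⟩ := Quotient.exact hh
    have h2 : b.1 = a.1 * k := congrArg Prod.fst hk
    exact QuotientGroup.eq.2 (by simp [h2])

/-- The left action of `G` covers left multiplication on `G ⧸ K`. -/
theorem Bundle.proj_left (lam : K →* H) (g : G) (p : Bundle lam) :
    Bundle.proj lam (Bundle.left lam g p) = g • Bundle.proj lam p := by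
  induction p using Quotient.inductionOn with | _ a => rfl

/-- The left action of `G` commutes with the right action of `H`. -/
theorem Bundle.left_right (lam : K →* H) (g : G) (p : Bundle lam) (h : H) :
    Bundle.left lam g (Bundle.right lam p h) = Bundle.right lam (Bundle.left lam g p) h := by
  induction p using Quotient.inductionOn with | _ a => rfl

end Bundle

section Geometry

variable {EG : Type*} [NormedAddCommGroup EG] [NormedSpace ℝ EG]
  {G : Type*} [TopologicalSpace G] [ChartedSpace EG G] [Group G]
  {EK : Type*} [NormedAddCommGroup EK] [NormedSpace ℝ EK]
  (K : Subgroup G) [ChartedSpace EK K]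
  {EH : Type*} [NormedAddCommGroup EH] [NormedSpace ℝ EH]
  {H : Type*} [TopologicalSpace H] [ChartedSpace EH H] [Group H]

/-- The derivative `𝔨 → 𝔤` of the inclusion `K → G`. Its range is `𝔨` as a subspace of `𝔤`. -/
def inclLie : GroupLieAlgebra 𝓘(ℝ, EK) K →L[ℝ] GroupLieAlgebra 𝓘(ℝ, EG) G := lieMap K.subtype

/-- `𝔤 = 𝔨 ⊕ 𝔰` and `Ad_k(𝔰) ⊆ 𝔨₀ ⊕ 𝔰` for every `k ∈ K`: the decomposition shows that `G ⧸ K` is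
`𝔨₀`-reductive, where `𝔨₀` is a subspace of `𝔨`. -/
structure IsReductiveMod (k₀ : Submodule ℝ (GroupLieAlgebra 𝓘(ℝ, EK) K))
    (s : Submodule ℝ (GroupLieAlgebra 𝓘(ℝ, EG) G)) : Prop where
  isCompl : IsCompl (LinearMap.range (inclLie (EG := EG) (EK := EK) K).toLinearMap) s
  ad_mem : ∀ (k : K), ∀ v ∈ s,
    Ad (k : G) v ∈ Submodule.map (inclLie (EG := EG) (EK := EK) K).toLinearMap k₀ ⊔ s

variable (EK) in
/-- The decomposition `𝔤 = 𝔨 ⊕ 𝔰` is reductive: `Ad_k(𝔰) ⊆ 𝔰` for every `k ∈ K`. -/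
def IsReductive (s : Submodule ℝ (GroupLieAlgebra 𝓘(ℝ, EG) G)) : Prop :=
  IsReductiveMod (EK := EK) K ⊥ s

variable (EK) in
/-- A form `θ` on `G` with values in `𝔨` is `proj_𝔨 ∘ Θ`, where `Θ` is the left-invariant
Maurer-Cartan form of `G` and `proj_𝔨` is the projection along `𝔰`. -/
def IsMaurerCartanProj (s : Submodule ℝ (GroupLieAlgebra 𝓘(ℝ, EG) G))
    (θ : LieForm EG G EK K) : Prop :=
  ∀ g : G,
    (∀ x : GroupLieAlgebra 𝓘(ℝ, EK) K, θ g (mulInvariantVectorField (inclLie K x) g) = x) ∧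
    ∀ v ∈ s, θ g (mulInvariantVectorField v g) = 0

variable {K}
variable (lam : K →* H)

variable (EK EH) in
/-- The decomposition `𝔤 = 𝔨 ⊕ 𝔰` shows that `G ⧸ K` is `lam`-reductive, that is,
`ker(lam_*)`-reductive. -/
def IsLambdaReductive (s : Submodule ℝ (GroupLieAlgebra 𝓘(ℝ, EG) G)) : Prop :=
  IsReductiveMod (EK := EK) K
    (LinearMap.ker (lieMap (E := EK) (E' := EH) lam).toLinearMap) s

variable (EK) in
/-- Wang maps: linear maps `W : 𝔤 → 𝔥` with `W = lam_*` on `𝔨` and `W ∘ Ad_k = Ad_{lam(k)} ∘ W`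
for `k ∈ K`. -/
structure IsWangMap (W : GroupLieAlgebra 𝓘(ℝ, EG) G →ₗ[ℝ] GroupLieAlgebra 𝓘(ℝ, EH) H) : Prop where
  eq_on : ∀ x : GroupLieAlgebra 𝓘(ℝ, EK) K, W (inclLie K x) = lieMap lam x
  equivariant : ∀ (k : K) (v : GroupLieAlgebra 𝓘(ℝ, EG) G), W (Ad (k : G) v) = Ad (lam k) (W v)

variable (EK) in
/-- `W` is `lam_*` on `𝔨` and `0` on `𝔰`. -/
def IsCanonicalMap (s : Submodule ℝ (GroupLieAlgebra 𝓘(ℝ, EG) G))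
    (W : GroupLieAlgebra 𝓘(ℝ, EG) G →ₗ[ℝ] GroupLieAlgebra 𝓘(ℝ, EH) H) : Prop :=
  (∀ x : GroupLieAlgebra 𝓘(ℝ, EK) K, W (inclLie K x) = lieMap lam x) ∧ ∀ v ∈ s, W v = 0

variable (EG EK EH K) in
/-- The model vector space of `P_lam`: its dimension is `dim G - dim K + dim H`. -/
abbrev Model : Type :=
  EuclideanSpace ℝ
    (Fin (Module.finrank ℝ EG - Module.finrank ℝ EK + Module.finrank ℝ EH))

variable {EP : Type*} [NormedAddCommGroup EP] [NormedSpace ℝ EP]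

variable (EP EG EH) in
/-- The smooth structure on `P_lam` is the quotient structure: `G × H → P_lam` is a smooth
submersion. At most one smooth structure on the space `P_lam` has this property. -/
def IsQuotientManifold [ChartedSpace EP (Bundle lam)] [IsManifold 𝓘(ℝ, EP) ∞ (Bundle lam)] : Prop :=
  Manifold.IsSubmersion (𝓘(ℝ, EG).prod 𝓘(ℝ, EH)) 𝓘(ℝ, EP) ∞ (Bundle.mk lam)

/-- The invariant form `η` on `P_lam` corresponds to `W`: `η_p(x*_p) = W x` for `x ∈ 𝔤`, where
`p = [1, 1]` and `x*_p` is the image of `x` under the derivative at `1` of `g ↦ g · p`. -/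
def IsAssociated [ChartedSpace EP (Bundle lam)]
    (W : GroupLieAlgebra 𝓘(ℝ, EG) G →ₗ[ℝ] GroupLieAlgebra 𝓘(ℝ, EH) H)
    (η : LieForm EP (Bundle lam) EH H) : Prop :=
  ∀ x : GroupLieAlgebra 𝓘(ℝ, EG) G,
    η (Bundle.left lam 1 (Bundle.mk lam (1, 1)))
      (mfderiv 𝓘(ℝ, EG) 𝓘(ℝ, EP) (fun g : G => Bundle.left lam g (Bundle.mk lam (1, 1))) 1 x) = W x

/-- `η` is induced by the form `θ` on `G` via the bundle map `f : G → P_lam`, `f g = [g, 1]`: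
`f^* η = lam_* ∘ θ`. -/
def IsInduced [ChartedSpace EP (Bundle lam)] (θ : LieForm EG G EK K)
    (η : LieForm EP (Bundle lam) EH H) : Prop :=
  ∀ (g : G) (v : TangentSpace 𝓘(ℝ, EG) g),
    η (Bundle.mk lam (g, 1))
      (mfderiv 𝓘(ℝ, EG) 𝓘(ℝ, EP) (fun x : G => Bundle.mk lam (x, 1)) g v) = lieMap lam (θ g v)

end Geometry

end HomogeneousBundle

end

/-!
The canonical invariant connection on the homogeneous bundle `P_λ = G ×_λ H`.

The smooth structure on `P_λ` comes from local slices. Near `1`, the group `G` is a product of a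
transversal `σ : A → G` of `K` and `K` itself. As `K` carries the subspace topology, `A` may be
shrunk until `(x, k) ↦ σ x * k` is injective on all of `A × K`, and right translation by `K` makes
it a diffeomorphism onto an open set (`exists_isGroupSlice`). Left translates of this slice give
normal forms for the relation on `G × H`, hence charts of `P_λ` and local sections of `G × H →
P_λ` (`exists_isSliceAt_mk`, `exists_isSubmersion_of_isSliceAt`).

Forms on `P_λ` are handled through their pullbacks to `G × H`. For a Wang map `W` the pullback of
the corresponding connection has to be `Ad_{h⁻¹} ∘ W ∘ Θ_G + Θ_H`, where `Θ` denotes Maurer-Cartan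
forms (`wangForm`). This form is invariant under the action of `K` whose quotient is `P_λ`,
because `W` is equivariant, and kills the tangent vectors of the `K`-orbits, because `W = λ_*` on
`𝔨`. These vectors are the whole kernel of the derivative of `G × H → P_λ`, by a count of
dimensions. So the form descends (`exists_form_of_isWangMap`), and the descended form is an
invariant connection. Conversely, a connection on `P_λ` is determined by its pullback along the
map `g ↦ [g, 1]` (`pullback_eq_wangForm`), and for an invariant connection with Wang map `W` this
pullback is `W ∘ Θ_G` (`pullback_section_of_isInvariant`). This gives existence and uniqueness.

For a `λ`-reductive decomposition, the map that is `λ_*` on `𝔨` and zero on `𝔰` is a Wang map,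
since `Ad_k` sends `𝔰` to `ker λ_* ⊕ 𝔰`, on which the map vanishes (`IsCanonicalMap.isWangMap`).
In the reductive case the projection `𝔤 → 𝔨` along `𝔰` is the canonical map of the identity of
`K`, so it is a Wang map, and its composition with `Θ_G` is a connection on `G → G/K`. Its image
under `λ_*` is `W_λ ∘ Θ_G`, the pullback of the canonical connection along `g ↦ [g, 1]`; so the
connection that it induces on `P_λ` is the canonical one (`isInduced_and_unique`).
-/

noncomputable section

namespace HomogeneousBundle

open Set Topology Filter

/-! ### Submersions, immersions and their local sections -/

/-- The inverse function theorem for `C^∞` maps, with an inverse that is `C^∞` on its domain. -/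
theorem exists_openPartialHomeomorph_of_hasFDerivAt
    {E : Type*} [NormedAddCommGroup E] [NormedSpace ℝ E] [CompleteSpace E]
    {E' : Type*} [NormedAddCommGroup E'] [NormedSpace ℝ E']
    {f : E → E'} {U : Set E} {a : E} (hU : IsOpen U) (ha : a ∈ U) (hf : ContDiffOn ℝ ∞ f U)
    {T : E ≃L[ℝ] E'} (hT : HasFDerivAt f (T : E →L[ℝ] E') a) :
    ∃ c : OpenPartialHomeomorph E E', a ∈ c.source ∧ c.source ⊆ U ∧ ⇑c = f ∧
      ContDiffOn ℝ ∞ c.symm c.target := by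
  have hfa : ContDiffAt ℝ ∞ f a := hf.contDiffAt (hU.mem_nhds ha)
  -- the derivative of `f` stays invertible on the open set `V`, so the inverse is smooth there
  set V : Set E := U ∩ fderiv ℝ f ⁻¹' range ((↑) : (E ≃L[ℝ] E') → E →L[ℝ] E') with hV
  have hVo : IsOpen V :=
    (hf.continuousOn_fderiv_of_isOpen hU (by simp)).isOpen_inter_preimage hU
      (ContinuousLinearEquiv.isOpen (𝕜 := ℝ) (E := E) (F := E'))
  have haV : a ∈ V := ⟨ha, T, hT.fderiv.symm⟩
  set c := (hfa.toOpenPartialHomeomorph f hT (by simp)).restrOpen V hVo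
  have hcf : ⇑c = f := rfl
  have hcs : c.source ⊆ V := by
    intro x hx
    rw [OpenPartialHomeomorph.restrOpen_source] at hx
    exact hx.2
  refine ⟨c, ?_, fun x hx => (hcs hx).1, hcf, ?_⟩
  · rw [OpenPartialHomeomorph.restrOpen_source]
    exact ⟨hfa.mem_toOpenPartialHomeomorph_source hT (by simp), haV⟩
  · intro y hy
    have hx : c.symm y ∈ V := hcs (c.map_target hy)
    obtain ⟨S, hS⟩ := hx.2
    have hfx : ContDiffAt ℝ ∞ f (c.symm y) := hf.contDiffAt (hU.mem_nhds hx.1)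
    refine (c.contDiffAt_symm (f₀' := S) hy ?_ ?_).contDiffWithinAt
    · rw [hS, hcf]
      exact (hfx.differentiableAt (by simp)).hasFDerivAt
    · rw [hcf]; exact hfx

section Submersion

variable {E : Type*} [NormedAddCommGroup E] [NormedSpace ℝ E] [FiniteDimensional ℝ E]
  {A : Type*} [TopologicalSpace A] {I : ModelWithCorners ℝ E A} [I.Boundaryless]
  {M : Type*} [TopologicalSpace M] [ChartedSpace A M] [IsManifold I ∞ M]
  {E' : Type*} [NormedAddCommGroup E'] [NormedSpace ℝ E'] [FiniteDimensional ℝ E']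
  {A' : Type*} [TopologicalSpace A'] {J : ModelWithCorners ℝ E' A'}
  {N : Type*} [TopologicalSpace N] [ChartedSpace A' N] [IsManifold J ∞ N]
  {F : Type*} [NormedAddCommGroup F] [NormedSpace ℝ F] [FiniteDimensional ℝ F]

/-- A surjective linear map `D` completes to an isomorphism `(D, p)`. -/
theorem exists_continuousLinearEquiv_fst_eq (D : E →L[ℝ] E') (hD : Function.Surjective D)
    (hF : Module.finrank ℝ E = Module.finrank ℝ E' + Module.finrank ℝ F) :
    ∃ (T : E ≃L[ℝ] E' × F) (p : E →L[ℝ] F), ∀ v, T v = (D v, p v) := by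
  have hker : Module.finrank ℝ (LinearMap.ker D.toLinearMap) = Module.finrank ℝ F := by
    have h1 := D.toLinearMap.finrank_range_add_finrank_ker
    rw [LinearMap.range_eq_top.2 hD, finrank_top] at h1
    omega
  let e : LinearMap.ker D.toLinearMap ≃ₗ[ℝ] F := LinearEquiv.ofFinrankEq _ _ hker
  obtain ⟨r, hr⟩ := LinearMap.exists_leftInverse_of_injective
    (LinearMap.ker D.toLinearMap).subtype (by simp)
  let p : E →ₗ[ℝ] F := e.toLinearMap ∘ₗ r
  have hinj : Function.Injective (D.toLinearMap.prod p) := by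
    rw [← LinearMap.ker_eq_bot, LinearMap.ker_eq_bot']
    intro v hv
    have h1 : D v = 0 := congrArg Prod.fst hv
    have h2 : e (r v) = 0 := congrArg Prod.snd hv
    have h3 : r v = ⟨v, h1⟩ := LinearMap.congr_fun hr ⟨v, h1⟩
    rw [h3, LinearEquiv.map_eq_zero_iff] at h2
    exact congrArg Subtype.val h2
  refine ⟨(LinearEquiv.ofInjectiveOfFinrankEq (D.toLinearMap.prod p) hinj
    (by rw [hF, Module.finrank_prod])).toContinuousLinearEquiv,
    LinearMap.toContinuousLinearMap p, ?_⟩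
  intro v
  rfl

/-- A smooth map of boundaryless finite-dimensional manifolds with a surjective derivative at `x`
is a submersion at `x`. -/
theorem isSubmersionAtOfComplement_of_surjective {f : M → N} (hf : ContMDiff I J ∞ f) {x : M}
    (hx : Function.Surjective (mfderiv I J f x))
    (hF : Module.finrank ℝ E = Module.finrank ℝ E' + Module.finrank ℝ F) :
    Manifold.IsSubmersionAtOfComplement F I J ∞ f x := by
  set φ := extChartAt I x
  set ψ := extChartAt J (f x)
  set g : E → E' := ψ ∘ f ∘ φ.symm with hg
  set U : Set E := φ.target ∩ φ.symm ⁻¹' (f ⁻¹' ψ.source) with hUdef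
  have hU : IsOpen U := (continuousOn_extChartAt_symm x).isOpen_inter_preimage
    (isOpen_extChartAt_target x) ((isOpen_extChartAt_source (f x)).preimage hf.continuous)
  have hxU : φ x ∈ U := by simp [hUdef, φ, ψ]
  have hgU : ContDiffOn ℝ ∞ g U := by
    rw [← contMDiffOn_iff_contDiffOn]
    refine (contMDiffOn_extChartAt (x := f x)).comp
      (hf.comp_contMDiffOn ((contMDiffOn_extChartAt_symm x).mono inter_subset_left)) ?_
    intro y hy
    simpa [ψ] using hy.2
  let D : E →L[ℝ] E' := mfderiv I J f x
  have hD : HasFDerivAt g D (φ x) := by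
    have h : HasFDerivWithinAt g D (range I) (φ x) :=
      (hf.mdifferentiable (by simp) x).hasMFDerivAt.2
    rwa [I.range_eq_univ, hasFDerivWithinAt_univ] at h
  obtain ⟨T, p, hT⟩ := exists_continuousLinearEquiv_fst_eq (F := F) D hx hF
  have hG : HasFDerivAt (fun u => (g u, p u)) (T : E →L[ℝ] E' × F) (φ x) := by
    have h : (T : E →L[ℝ] E' × F) = D.prod p :=
      ContinuousLinearMap.ext hT
    rw [h]
    exact hD.prodMk p.hasFDerivAt
  -- in the coordinates `(g, p)` on `M`, corrected by `T.symm`, the map `f` is the first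
  -- component of `T`
  obtain ⟨c, hac, hcU, hcG, hcs⟩ := exists_openPartialHomeomorph_of_hasFDerivAt hU hxU
    (hgU.prodMk p.contDiff.contDiffOn) hG
  let d : OpenPartialHomeomorph M A :=
    (((chartAt A x).trans I.toHomeomorph.toOpenPartialHomeomorph).trans c).trans
      (T.symm.toHomeomorph.trans I.toHomeomorph.symm).toOpenPartialHomeomorph
  have hd : ∀ y, d y = I.symm (T.symm (c (φ y))) := fun y => rfl
  have hdsymm : ∀ z, d.symm z = φ.symm (c.symm (T (I z))) := fun z => rfl
  have hds : d.source = φ.source ∩ φ ⁻¹' c.source := by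
    ext y
    simp [d, φ]
  have hdt : ∀ z ∈ d.target, T (I z) ∈ c.target ∧ c.symm (T (I z)) ∈ φ.target := by
    intro z hz
    have h2 := d.map_target hz
    rw [hds] at h2
    have h1 : T (I z) ∈ c.target := by
      simp [d] at hz
      exact hz.1
    exact ⟨h1, (hcU (c.map_target h1)).1⟩
  refine Manifold.IsSubmersionAtOfComplement.mk_of_continuousAt hf.continuous.continuousAt T d
    (chartAt A' (f x)) ?_ (mem_chart_source _ _) ?_ (IsManifold.chart_mem_maximalAtlas _) ?_
  · rw [hds]
    exact ⟨mem_extChartAt_source x, hac⟩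
  · refine d.mem_maximalAtlas_of_contMDiffOn ?_ ?_
    · have h1 : ContMDiffOn I 𝓘(ℝ, E) ∞ (fun y => T.symm (c (φ y))) d.source := by
        have h2 : ContDiffOn ℝ ∞ (fun u => T.symm (c u)) c.source := by
          rw [hcG]
          exact T.symm.contDiff.comp_contDiffOn
            ((hgU.prodMk p.contDiff.contDiffOn).mono hcU)
        refine h2.contMDiffOn.comp ((contMDiffOn_extChartAt (x := x)).mono ?_) ?_
        · rw [hds, extChartAt_source]; exact inter_subset_left
        · rw [hds]; exact inter_subset_right
      exact I.contMDiffOn_symm.comp h1 (fun y _ => by simp [I.range_eq_univ])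
    · have h1 : ContMDiffOn I 𝓘(ℝ, E) ∞ (fun z => c.symm (T (I z))) d.target :=
        hcs.contMDiffOn.comp ((T.contDiff.contMDiff.comp I.contMDiff).contMDiffOn)
          (fun z hz => (hdt z hz).1)
      exact (contMDiffOn_extChartAt_symm x).comp h1 (fun z hz => (hdt z hz).2)
  · intro z hz
    have hz' : I.symm z ∈ d.target := by simpa using hz.2
    have h1 := (hdt _ hz').1
    rw [I.right_inv (by simp [I.range_eq_univ])] at h1
    have h2 : (d.extend I).symm z = φ.symm (c.symm (T z)) := by
      change d.symm (I.symm z) = _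
      rw [hdsymm, I.right_inv (by simp [I.range_eq_univ])]
    have h3 : (g (c.symm (T z)), p (c.symm (T z))) = T z := by
      have := c.right_inv h1
      rwa [hcG] at this
    change ψ (f ((d.extend I).symm z)) = (T z).1
    rw [h2]
    exact congrArg Prod.fst h3

end Submersion

section NormalForms

variable {E : Type*} [NormedAddCommGroup E] [NormedSpace ℝ E]
  {A : Type*} [TopologicalSpace A] {I : ModelWithCorners ℝ E A}
  {M : Type*} [TopologicalSpace M] [ChartedSpace A M]
  {E' : Type*} [NormedAddCommGroup E'] [NormedSpace ℝ E']
  {A' : Type*} [TopologicalSpace A'] {J : ModelWithCorners ℝ E' A'}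
  {N : Type*} [TopologicalSpace N] [ChartedSpace A' N]
  {F : Type*} [NormedAddCommGroup F] [NormedSpace ℝ F]

/-- A smooth map with a smooth local section through `x` has a surjective derivative at `x`. -/
theorem mfderiv_surjective_of_section {f : M → N} {x : M} {s : N → M}
    (hf : MDifferentiableAt I J f x) (hs : MDifferentiableAt J I s (f x)) (hsx : s (f x) = x)
    (h : ∀ᶠ y in 𝓝 (f x), f (s y) = y) : Function.Surjective (mfderiv I J f x) := by
  have h1 : mfderiv J J (f ∘ s) (f x) = ContinuousLinearMap.id ℝ _ := by
    rw [Filter.EventuallyEq.mfderiv_eq (f₁ := f ∘ s) (f := id) h, mfderiv_id]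
  rw [mfderiv_comp_of_eq hf hs hsx] at h1
  have h2 : ∀ y, y = x → ∀ u : E,
      (mfderiv I J f y : E →L[ℝ] E') u = (mfderiv I J f x : E →L[ℝ] E') u := by
    rintro _ rfl u
    rfl
  intro w
  exact ⟨mfderiv J I s (f x) w, (h2 _ hsx _).symm.trans (DFunLike.congr_fun h1 w)⟩

/-- Without boundary, `contMDiffOn_extend_symm` holds on the whole target. -/
theorem contMDiffOn_extend_symm_target [I.Boundaryless] {e : OpenPartialHomeomorph M A}
    (he : e ∈ IsManifold.maximalAtlas I ∞ M) :
    ContMDiffOn 𝓘(ℝ, E) I ∞ (e.extend I).symm (e.extend I).target := by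
  refine (contMDiffOn_extend_symm he).mono ?_
  intro z hz
  exact ⟨I.symm z, by simpa using hz.2, I.right_inv (by simp [I.range_eq_univ])⟩

/-- A submersion has a smooth local section through every point. -/
theorem exists_section_of_isSubmersionAtOfComplement [I.Boundaryless] {f : M → N} {x : M}
    (h : Manifold.IsSubmersionAtOfComplement F I J ∞ f x) :
    ∃ (s : N → M) (O : Set N), IsOpen O ∧ f x ∈ O ∧ ContMDiffOn J I ∞ s O ∧ s (f x) = x ∧
      ∀ y ∈ O, f (s y) = y := by
  set φ := h.domChart.extend I
  set ψ := h.codChart.extend J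
  have hxφ : x ∈ φ.source := by
    rw [OpenPartialHomeomorph.extend_source]; exact h.mem_domChart_source
  have hw : ∀ z ∈ φ.target, ψ (f (φ.symm z)) = (h.equiv z).1 := fun z hz => h.writtenInCharts hz
  -- in the charts, the section fixes the coordinates of `x` along the fibre
  let q : N → E := fun y => h.equiv.symm (ψ y, (h.equiv (φ x)).2)
  have hqx : q (f x) = φ x := by
    have h1 := hw _ (φ.map_source hxφ)
    rw [φ.left_inv hxφ] at h1
    simp [q, h1]
  have hq : ContMDiffOn J 𝓘(ℝ, E) ∞ q h.codChart.source := by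
    have h2 : ContDiff ℝ ∞ (fun u : E' => h.equiv.symm (u, (h.equiv (φ x)).2)) := by fun_prop
    exact h2.contMDiff.comp_contMDiffOn
      (OpenPartialHomeomorph.contMDiffOn_extend h.codChart_mem_maximalAtlas)
  have hto : IsOpen φ.target := OpenPartialHomeomorph.isOpen_extend_target _
  refine ⟨fun y => φ.symm (q y), h.codChart.source ∩ q ⁻¹' φ.target,
    hq.continuousOn.isOpen_inter_preimage h.codChart.open_source hto,
    ⟨h.mem_codChart_source, ?_⟩, ?_, ?_, ?_⟩
  · rw [mem_preimage, hqx]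
    exact φ.map_source hxφ
  · exact (contMDiffOn_extend_symm_target h.domChart_mem_maximalAtlas).comp
      (hq.mono inter_subset_left) fun y hy => hy.2
  · simp only [hqx]
    exact φ.left_inv hxφ
  · rintro y ⟨hy', hy⟩
    have h4 : φ.symm (q y) ∈ h.domChart.source := by
      have := φ.map_target hy
      rwa [OpenPartialHomeomorph.extend_source] at this
    have h5 := hw _ hy
    simp only [q, ContinuousLinearEquiv.apply_symm_apply] at h5
    apply ψ.injOn _ _ h5
    · rw [OpenPartialHomeomorph.extend_source]; exact h.source_subset_preimage_source h4
    · rwa [OpenPartialHomeomorph.extend_source]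

/-- An immersion has a smooth local left inverse, and so its derivative is injective. -/
theorem mfderiv_injective_of_isImmersionAtOfComplement [I.Boundaryless] {f : M → N} {x : M}
    (h : Manifold.IsImmersionAtOfComplement F I J ∞ f x) :
    Function.Injective (mfderiv I J f x) := by
  set φ := h.domChart.extend I
  set ψ := h.codChart.extend J
  have hxφ : x ∈ φ.source := by
    rw [OpenPartialHomeomorph.extend_source]; exact h.mem_domChart_source
  have hw : ∀ z ∈ φ.target, ψ (f (φ.symm z)) = h.equiv (z, 0) := fun z hz => h.writtenInCharts hz
  have hψ : ContMDiffAt J 𝓘(ℝ, E') ∞ ψ (f x) :=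
    OpenPartialHomeomorph.contMDiffAt_extend h.codChart_mem_maximalAtlas h.mem_codChart_source
  have hto : IsOpen φ.target := OpenPartialHomeomorph.isOpen_extend_target _
  have h3 : ContMDiffOn 𝓘(ℝ, E) I ∞ φ.symm φ.target :=
    contMDiffOn_extend_symm_target h.domChart_mem_maximalAtlas
  -- in the charts, `r` is the projection to the first factor, a left inverse of `f` near `x`
  let r : N → M := fun y => φ.symm (h.equiv.symm (ψ y)).1
  have hr : ∀ y ∈ φ.source, r (f y) = y := by
    intro y hy
    have h1 := hw _ (φ.map_source hy)
    rw [φ.left_inv hy] at h1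
    simp only [r, h1, ContinuousLinearEquiv.symm_apply_apply]
    exact φ.left_inv hy
  have hr' : ContMDiffAt J I ∞ r (f x) := by
    have h2 : ContDiff ℝ ∞ (fun u : E' => (h.equiv.symm u).1) := by fun_prop
    refine ContMDiffAt.comp (f x) (h3.contMDiffAt (hto.mem_nhds ?_))
      (h2.contMDiff.contMDiffAt.comp _ hψ)
    have h1 := hw _ (φ.map_source hxφ)
    rw [φ.left_inv hxφ] at h1
    simp only [h1, ContinuousLinearEquiv.symm_apply_apply]
    exact φ.map_source hxφ
  have hev : r ∘ f =ᶠ[𝓝 x] id := by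
    filter_upwards [h.domChart.open_source.mem_nhds h.mem_domChart_source] with y hy
    exact hr y (by rwa [OpenPartialHomeomorph.extend_source])
  have h1 : mfderiv I I (r ∘ f) x = ContinuousLinearMap.id ℝ _ := by
    rw [hev.mfderiv_eq, mfderiv_id]
  rw [mfderiv_comp x (hr'.mdifferentiableAt (by simp)) (h.contMDiffAt.mdifferentiableAt (by simp))]
    at h1
  intro v w hvw
  have hv : mfderiv J I r (f x) (mfderiv I J f x v) = v := DFunLike.congr_fun h1 v
  have hw : mfderiv J I r (f x) (mfderiv I J f x w) = w := DFunLike.congr_fun h1 w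
  rw [← hv, ← hw, hvw]

end NormalForms

/-! ### Quotient manifolds from slices -/

section QuotientManifold

variable {E : Type*} [NormedAddCommGroup E] [NormedSpace ℝ E]
  {A : Type*} [TopologicalSpace A] (I : ModelWithCorners ℝ E A)
  {M : Type*} [TopologicalSpace M] [ChartedSpace A M]
  {B : Type*} [TopologicalSpace B]
  {F : Type*} [NormedAddCommGroup F] [NormedSpace ℝ F]

/-- A slice of `q : M → B` through `m`: a `q`-saturated open neighbourhood `O` of `m` with a smooth
submersion `c : O → V ⊆ F` whose fibres are those of `q`, and a smooth section `s` of `c` through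
`m`. -/
structure IsSliceAt (q : M → B) (m : M) (O : Set M) (V : Set F) (c : M → F) (s : F → M) : Prop where
  isOpen_source : IsOpen O
  isOpen_target : IsOpen V
  mem_source : m ∈ O
  saturated : ∀ a ∈ O, ∀ b, q a = q b → b ∈ O ∧ c a = c b
  contMDiffOn : ContMDiffOn I 𝓘(ℝ, F) ∞ c O
  contMDiffOn_section : ContMDiffOn 𝓘(ℝ, F) I ∞ s V
  mapsTo : MapsTo c O V
  mapsTo_section : MapsTo s V O
  right_inv : ∀ x ∈ V, c (s x) = x
  left_inv : ∀ a ∈ O, q (s (c a)) = q a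
  section_eq : s (c m) = m

/-- The charts of `B` that are compatible with the smooth structure of `M`: read through
`q : M → B` they are smooth, and their inverses lift to smooth maps to `M`. -/
def quotientAtlas (F : Type*) [NormedAddCommGroup F] [NormedSpace ℝ F] (q : M → B) :
    Set (OpenPartialHomeomorph B F) :=
  {e | ContMDiffOn I 𝓘(ℝ, F) ∞ (e ∘ q) (q ⁻¹' e.source) ∧
    ∃ s : F → M, ContMDiffOn 𝓘(ℝ, F) I ∞ s e.target ∧ ∀ x ∈ e.target, q (s x) = e.symm x}

variable {I}

/-- The submersion `c` of a slice descends to a chart of `B`, whose inverse lifts to the section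
`s`. -/
theorem IsSliceAt.exists_mem_quotientAtlas {q : M → B} (hq : IsOpenQuotientMap q) {m : M}
    {O : Set M} {V : Set F} {c : M → F} {s : F → M} (h : IsSliceAt I q m O V c s) :
    ∃ e ∈ quotientAtlas I F q, q m ∈ e.source ∧ ContMDiffOn 𝓘(ℝ, F) I ∞ s e.target ∧
      (∀ x ∈ e.target, q (s x) = e.symm x) ∧ s (e (q m)) = m := by
  let r : B → M := Function.surjInv hq.surjective
  have hr : ∀ b, q (r b) = b := Function.surjInv_eq hq.surjective
  have hrO : ∀ a ∈ O, r (q a) ∈ O ∧ c (r (q a)) = c a := fun a ha =>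
    ⟨(h.saturated a ha _ (hr _).symm).1, (h.saturated a ha _ (hr _).symm).2.symm⟩
  have hpre : q ⁻¹' (q '' O) = O := by
    refine Subset.antisymm ?_ (subset_preimage_image _ _)
    rintro b ⟨a, ha, hab⟩
    exact (h.saturated a ha b hab).1
  have hO : IsOpen (q '' O) := hq.isOpenMap _ h.isOpen_source
  have hcr : EqOn ((c ∘ r) ∘ q) c O := fun a ha => (hrO a ha).2
  let e : OpenPartialHomeomorph B F :=
    { toFun := c ∘ r
      invFun := q ∘ s
      source := q '' O
      target := V
      map_source' := by
        rintro _ ⟨a, ha, rfl⟩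
        exact h.mapsTo (hrO a ha).1
      map_target' := fun x hx => ⟨s x, h.mapsTo_section hx, rfl⟩
      left_inv' := by
        rintro _ ⟨a, ha, rfl⟩
        exact (h.left_inv _ (hrO a ha).1).trans (hr _)
      right_inv' := fun x hx => (hrO _ (h.mapsTo_section hx)).2.trans (h.right_inv x hx)
      open_source := hO
      open_target := h.isOpen_target
      continuousOn_toFun := by
        rw [hq.isQuotientMap.continuousOn_isOpen_iff hO, hpre]
        exact h.contMDiffOn.continuousOn.congr hcr
      continuousOn_invFun := hq.continuous.comp_continuousOn h.contMDiffOn_section.continuousOn }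
  refine ⟨e, ⟨?_, s, h.contMDiffOn_section, fun x _ => rfl⟩, ⟨m, h.mem_source, rfl⟩,
    h.contMDiffOn_section, fun x _ => rfl, ?_⟩
  · change ContMDiffOn I 𝓘(ℝ, F) ∞ ((c ∘ r) ∘ q) (q ⁻¹' (q '' O))
    rw [hpre]
    exact h.contMDiffOn.congr hcr
  · change s (c (r (q m))) = m
    rw [(hrO m h.mem_source).2, h.section_eq]

/-- If an open quotient map `q : M → B` has a slice through every point of the manifold `M`, then
`B` is a manifold and `q` is a submersion. -/
theorem exists_isSubmersion_of_isSliceAt [FiniteDimensional ℝ E] [I.Boundaryless]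
    [IsManifold I ∞ M] [FiniteDimensional ℝ F]
    {F' : Type*} [NormedAddCommGroup F'] [NormedSpace ℝ F'] [FiniteDimensional ℝ F']
    {q : M → B} (hq : IsOpenQuotientMap q)
    (h : ∀ m : M, ∃ (O : Set M) (V : Set F) (c : M → F) (s : F → M), IsSliceAt I q m O V c s)
    (hF : Module.finrank ℝ E = Module.finrank ℝ F + Module.finrank ℝ F') :
    ∃ (_ : ChartedSpace F B) (_ : IsManifold 𝓘(ℝ, F) ∞ B),
      Manifold.IsSubmersion I 𝓘(ℝ, F) ∞ q := by
  choose O V c s hs using h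
  choose e heA hme hse hqs hsm using fun m => (hs m).exists_mem_quotientAtlas hq
  let r : B → M := Function.surjInv hq.surjective
  have hr : ∀ b, q (r b) = b := Function.surjInv_eq hq.surjective
  let cB : ChartedSpace F B :=
    { atlas := quotientAtlas I F q
      chartAt := fun b => e (r b)
      mem_chart_source := fun b => by
        have := hme (r b)
        rwa [hr] at this
      chart_mem_atlas := fun b => heA _ }
  have hmB : IsManifold 𝓘(ℝ, F) ∞ B := by
    -- `e₂ ∘ e₁.symm = (e₂ ∘ q) ∘ s₁` for a smooth lift `s₁` of `e₁.symm`
    refine isManifold_of_contDiffOn _ _ _ ?_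
    rintro e₁ e₂ ⟨-, s₁, hs₁, hq₁⟩ ⟨he₂, -⟩
    have hsrc : ∀ x ∈ (e₁.symm.trans e₂).source, x ∈ e₁.target ∧ e₁.symm x ∈ e₂.source := by
      intro x hx
      rw [OpenPartialHomeomorph.trans_source] at hx
      exact hx
    rw [← contMDiffOn_iff_contDiffOn]
    have h1 : ContMDiffOn 𝓘(ℝ, F) 𝓘(ℝ, F) ∞ ((e₂ ∘ q) ∘ s₁) (e₁.symm.trans e₂).source := by
      refine he₂.comp (hs₁.mono fun x hx => (hsrc x hx).1) fun x hx => ?_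
      change q (s₁ x) ∈ e₂.source
      rw [hq₁ x (hsrc x hx).1]
      exact (hsrc x hx).2
    have h2 : (𝓘(ℝ, F).symm ⁻¹' (e₁.symm.trans e₂).source ∩ range 𝓘(ℝ, F)) =
        (e₁.symm.trans e₂).source := by
      ext x; simp
    rw [h2]
    refine h1.congr fun x hx => ?_
    change e₂ (e₁.symm x) = e₂ (q (s₁ x))
    rw [hq₁ x (hsrc x hx).1]
  have hmax : ∀ m, e m ∈ IsManifold.maximalAtlas 𝓘(ℝ, F) ∞ B := fun m =>
    IsManifold.subset_maximalAtlas (heA m)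
  have hqsm : ContMDiff I 𝓘(ℝ, F) ∞ q := by
    intro m
    have h1 : ContMDiffAt I 𝓘(ℝ, F) ∞ (e m ∘ q) m :=
      (heA m).1.contMDiffAt (((e m).open_source.preimage hq.continuous).mem_nhds (hme m))
    have h2 : ContMDiffAt 𝓘(ℝ, F) 𝓘(ℝ, F) ∞ (e m).symm ((e m) (q m)) :=
      contMDiffAt_symm_of_mem_maximalAtlas (hmax m) ((e m).map_source (hme m))
    refine (ContMDiffAt.comp m (g := (e m).symm) h2 h1).congr_of_eventuallyEq ?_
    filter_upwards [((e m).open_source.preimage hq.continuous).mem_nhds (hme m)] with y hy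
    exact ((e m).left_inv hy).symm
  refine ⟨cB, hmB, Manifold.IsSubmersionOfComplement.isSubmersion (F := F') fun m => ?_⟩
  refine isSubmersionAtOfComplement_of_surjective hqsm ?_ hF
  -- `s m ∘ e m` is a local section of `q` through `m`
  have h3 : ContMDiffAt 𝓘(ℝ, F) I ∞ (fun b => s m (e m b)) (q m) :=
    ContMDiffAt.comp (q m) (g := s m)
      ((hse m).contMDiffAt ((e m).open_target.mem_nhds ((e m).map_source (hme m))))
      (contMDiffAt_of_mem_maximalAtlas (hmax m) (hme m))
  refine mfderiv_surjective_of_section (s := fun b => s m (e m b))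
    (hqsm.mdifferentiable (by simp) m) (h3.mdifferentiableAt (by simp)) (hsm m) ?_
  filter_upwards [(e m).open_source.mem_nhds (hme m)] with b hb
  rw [hqs m _ ((e m).map_source hb), (e m).left_inv hb]

end QuotientManifold

/-! ### Slices for a Lie subgroup -/

section GroupSlice

variable {EG : Type*} [NormedAddCommGroup EG] [NormedSpace ℝ EG] [FiniteDimensional ℝ EG]
  {G : Type*} [TopologicalSpace G] [ChartedSpace EG G] [Group G] [LieGroup 𝓘(ℝ, EG) ∞ G]
  {EK : Type*} [NormedAddCommGroup EK] [NormedSpace ℝ EK]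
  (K : Subgroup G) [ChartedSpace EK K] [LieGroup 𝓘(ℝ, EK) ∞ K]
  {F : Type*} [NormedAddCommGroup F] [NormedSpace ℝ F]

/-- A local slice `σ : A → G` for the right multiplication of `K` on `G`: the map
`(x, k) ↦ σ x * k` is a diffeomorphism of `A × K` onto the open set `U`, with inverse `(ρ, κ)`. -/
structure IsGroupSlice (A : Set F) (σ : F → G) (U : Set G) (ρ : G → F) (κ : G → K) : Prop where
  isOpen_param : IsOpen A
  zero_mem : (0 : F) ∈ A
  map_zero : σ 0 = 1
  isOpen_image : IsOpen U
  contMDiffOn : ContMDiffOn 𝓘(ℝ, F) 𝓘(ℝ, EG) ∞ σ A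
  contMDiffOn_fst : ContMDiffOn 𝓘(ℝ, EG) 𝓘(ℝ, F) ∞ ρ U
  contMDiffOn_snd : ContMDiffOn 𝓘(ℝ, EG) 𝓘(ℝ, EK) ∞ κ U
  mul_mem : ∀ x ∈ A, ∀ k : K, σ x * k ∈ U
  fst_mul : ∀ x ∈ A, ∀ k : K, ρ (σ x * k) = x
  snd_mul : ∀ x ∈ A, ∀ k : K, κ (σ x * k) = k
  fst_mem : ∀ g ∈ U, ρ g ∈ A
  mul_eq : ∀ g ∈ U, σ (ρ g) * κ g = g

variable {K}

omit [FiniteDimensional ℝ EG] in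
/-- A local inverse of `(x, k) ↦ σ x * k` near `(0, 1)` spreads out to a slice: because `K` carries
the subspace topology, `(x, k) ↦ σ x * k` is injective on `A × K` for small `A`, and translation
by `K` on the right carries the local inverse to all of `A × K`. -/
theorem exists_isGroupSlice_of_localInverse {σ : F → G} (hσ0 : σ 0 = 1)
    {φ : OpenPartialHomeomorph K EK} (hφ : φ ∈ IsManifold.maximalAtlas 𝓘(ℝ, EK) ∞ K)
    (h1φ : (1 : K) ∈ φ.source) {S : Set (EK × F)} (hS : IsOpen S) (h0S : (φ 1, (0 : F)) ∈ S)
    (hσ : ∀ p ∈ S, ContMDiffAt 𝓘(ℝ, F) 𝓘(ℝ, EG) ∞ σ p.2)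
    {U₀ : Set G} (hU₀ : IsOpen U₀) {τ : G → EK × F}
    (hτ : ContMDiffOn 𝓘(ℝ, EG) 𝓘(ℝ, EK × F) ∞ τ U₀)
    (hτl : ∀ p ∈ S, σ p.2 * φ.symm p.1 ∈ U₀ ∧ τ (σ p.2 * φ.symm p.1) = p)
    (hτr : ∀ g ∈ U₀, τ g ∈ S → σ (τ g).2 * φ.symm (τ g).1 = g) :
    ∃ (A : Set F) (U : Set G) (ρ : G → F) (κ : G → K),
      IsGroupSlice (EG := EG) (EK := EK) K A σ U ρ κ := by
  have hGt : IsTopologicalGroup G := topologicalGroup_of_lieGroup 𝓘(ℝ, EG) ∞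
  obtain ⟨Y, A₁, hY, hA₁, h1Y, h0A₁, hYA⟩ := isOpen_prod_iff.1 hS _ _ h0S
  -- the neighbourhood `φ.source ∩ φ ⁻¹' Y` of `1` in `K` is cut out by an open subset `N` of `G`
  have hC : IsOpen (φ.source ∩ φ ⁻¹' Y) := φ.isOpen_inter_preimage hY
  obtain ⟨N, hN, hNC⟩ := isOpen_induced_iff.1 hC
  have h1N : (1 : G) ∈ N := by
    have h : (1 : K) ∈ Subtype.val ⁻¹' N := by rw [hNC]; exact ⟨h1φ, h1Y⟩
    exact h
  obtain ⟨A, hA, h0A, hAA₁, hAN⟩ : ∃ A : Set F, IsOpen A ∧ (0 : F) ∈ A ∧ A ⊆ A₁ ∧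
      ∀ x₁ ∈ A, ∀ x₂ ∈ A, (σ x₂)⁻¹ * σ x₁ ∈ N := by
    have hc : ContinuousAt σ 0 := (hσ _ h0S).continuousAt
    have h2 : ContinuousAt (fun p : F × F => (σ p.2)⁻¹ * σ p.1) (0, 0) :=
      (ContinuousAt.comp (f := Prod.snd) (x := ((0 : F), (0 : F))) hc continuousAt_snd).inv.mul
        (ContinuousAt.comp (f := Prod.fst) (x := ((0 : F), (0 : F))) hc continuousAt_fst)
    have h3 : (fun p : F × F => (σ p.2)⁻¹ * σ p.1) ⁻¹' N ∈ 𝓝 ((0 : F), (0 : F)) :=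
      h2 (hN.mem_nhds (by simpa [hσ0] using h1N))
    obtain ⟨A₂, A₃, hA₂, h0A₂, hA₃, h0A₃, hsub⟩ := mem_nhds_prod_iff'.1 h3
    refine ⟨A₁ ∩ (A₂ ∩ A₃), hA₁.inter (hA₂.inter hA₃), ⟨h0A₁, h0A₂, h0A₃⟩, inter_subset_left, ?_⟩
    intro x₁ h₁ x₂ h₂
    exact hsub (⟨h₁.2.1, h₂.2.2⟩ : (x₁, x₂) ∈ A₂ ×ˢ A₃)
  have hAS : ∀ x ∈ A, ∀ y ∈ Y, (y, x) ∈ S := fun x hx y hy => hYA ⟨hy, hAA₁ hx⟩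
  have hτσ : ∀ x ∈ A, ∀ k ∈ φ.source ∩ φ ⁻¹' Y, τ (σ x * k) = (φ k, x) := by
    intro x hx k hk
    have := (hτl _ (hAS x hx _ hk.2)).2
    rwa [φ.left_inv hk.1] at this
  -- if `σ x₁ * k₁ = σ x₂ * k₂`, then `k₂ * k₁⁻¹` lies in `N`, where `τ` separates points
  have hinj : ∀ x₁ ∈ A, ∀ x₂ ∈ A, ∀ k₁ k₂ : K, σ x₁ * k₁ = σ x₂ * k₂ → x₁ = x₂ ∧ k₁ = k₂ := by
    intro x₁ h₁ x₂ h₂ k₁ k₂ h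
    have hl : ((k₂ * k₁⁻¹ : K) : G) = (σ x₂)⁻¹ * σ x₁ := by
      push_cast
      rw [eq_inv_mul_iff_mul_eq, ← mul_assoc, ← h, mul_assoc, mul_inv_cancel, mul_one]
    have hlC : k₂ * k₁⁻¹ ∈ φ.source ∩ φ ⁻¹' Y := by
      rw [← hNC, mem_preimage, hl]
      exact hAN _ h₁ _ h₂
    have h3 := hτσ x₁ h₁ 1 ⟨h1φ, h1Y⟩
    have h4 := hτσ x₂ h₂ _ hlC
    rw [hl, mul_inv_cancel_left] at h4
    rw [OneMemClass.coe_one, mul_one, h4] at h3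
    refine ⟨(congrArg Prod.snd h3).symm, ?_⟩
    have h5 := φ.injOn hlC.1 h1φ (congrArg Prod.fst h3)
    exact (mul_inv_eq_one.1 h5).symm
  -- `P` is the inverse of the bijection `(x, k) ↦ σ x * k` from `A × K` to `U`
  let U : Set G := {g | ∃ p : F × K, p.1 ∈ A ∧ σ p.1 * p.2 = g}
  have hch : ∀ g, ∃ p : F × K, g ∈ U → p.1 ∈ A ∧ σ p.1 * p.2 = g := by
    intro g
    by_cases hg : g ∈ U
    · obtain ⟨p, hp⟩ := hg
      exact ⟨p, fun _ => hp⟩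
    · exact ⟨(0, 1), fun h => absurd h hg⟩
  choose P hP using hch
  have hPeq : ∀ x ∈ A, ∀ k : K, P (σ x * k) = (x, k) := by
    intro x hx k
    have h := hP _ ⟨(x, k), hx, rfl⟩
    obtain ⟨h1, h2⟩ := hinj _ h.1 _ hx _ _ h.2
    exact Prod.ext h1 h2
  -- near `σ x₀ * k₀`, the map `P` is `τ` translated by `k₀` on the right
  have hloc : ∀ g₀ ∈ U, U ∈ 𝓝 g₀ ∧ ContMDiffAt 𝓘(ℝ, EG) (𝓘(ℝ, F).prod 𝓘(ℝ, EK)) ∞ P g₀ := by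
    rintro _ ⟨⟨x₀, k₀⟩, hx₀, rfl⟩
    dsimp only at hx₀ ⊢
    have hτx : τ (σ x₀ * (k₀ : G) * (k₀ : G)⁻¹) = (φ 1, x₀) := by
      rw [mul_inv_cancel_right]
      simpa using hτσ x₀ hx₀ 1 ⟨h1φ, h1Y⟩
    have hx₀U : σ x₀ * (k₀ : G) * (k₀ : G)⁻¹ ∈ U₀ := by
      have := (hτl _ (hAS x₀ hx₀ _ h1Y)).1
      rw [φ.left_inv h1φ] at this
      simpa using this
    have hτs : ContMDiffAt 𝓘(ℝ, EG) 𝓘(ℝ, EK × F) ∞ (fun g : G => τ (g * (k₀ : G)⁻¹))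
        (σ x₀ * k₀) :=
      ContMDiffAt.comp (g := τ) _ (hτ.contMDiffAt (hU₀.mem_nhds hx₀U))
        (contMDiff_mul_right (a := (k₀ : G)⁻¹)).contMDiffAt
    have hmem : ∀ᶠ g in 𝓝 (σ x₀ * (k₀ : G)), g * (k₀ : G)⁻¹ ∈ U₀ ∧
        τ (g * (k₀ : G)⁻¹) ∈ Y ×ˢ A := by
      refine Filter.Eventually.and ?_ ?_
      · exact (continuous_mul_const ((k₀ : G)⁻¹)).continuousAt.preimage_mem_nhds
          (hU₀.mem_nhds hx₀U)
      · refine hτs.continuousAt ((hY.prod hA).mem_nhds ?_)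
        rw [hτx]
        exact ⟨h1Y, hx₀⟩
    have hform : ∀ᶠ g in 𝓝 (σ x₀ * (k₀ : G)), g ∈ U ∧
        P g = ((τ (g * (k₀ : G)⁻¹)).2, φ.symm (τ (g * (k₀ : G)⁻¹)).1 * k₀) := by
      filter_upwards [hmem] with g hg
      have h5 := hτr _ hg.1 (hAS _ hg.2.2 _ hg.2.1)
      have h6 : σ (τ (g * (k₀ : G)⁻¹)).2 * ((φ.symm (τ (g * (k₀ : G)⁻¹)).1 * k₀ : K) : G) = g := by
        rw [Subgroup.coe_mul, ← mul_assoc, h5, inv_mul_cancel_right]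
      refine ⟨⟨(_, _), hg.2.2, h6⟩, ?_⟩
      have h7 := hPeq _ hg.2.2 (φ.symm (τ (g * (k₀ : G)⁻¹)).1 * k₀)
      rwa [h6] at h7
    refine ⟨hform.mono fun g hg => hg.1, ?_⟩
    have hφs : ContMDiffAt 𝓘(ℝ, EK) 𝓘(ℝ, EK) ∞ φ.symm (φ 1) :=
      contMDiffAt_symm_of_mem_maximalAtlas hφ (φ.map_source h1φ)
    have hf1 : ContMDiffAt 𝓘(ℝ, EG) 𝓘(ℝ, EK) ∞ (fun g : G => (τ (g * (k₀ : G)⁻¹)).1)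
        (σ x₀ * k₀) :=
      ContMDiffAt.comp (g := Prod.fst) _ contDiff_fst.contMDiff.contMDiffAt hτs
    have hf2 : ContMDiffAt 𝓘(ℝ, EG) 𝓘(ℝ, F) ∞ (fun g : G => (τ (g * (k₀ : G)⁻¹)).2)
        (σ x₀ * k₀) :=
      ContMDiffAt.comp (g := Prod.snd) _ contDiff_snd.contMDiff.contMDiffAt hτs
    have hf3 : ContMDiffAt 𝓘(ℝ, EG) 𝓘(ℝ, EK) ∞
        (fun g : G => φ.symm (τ (g * (k₀ : G)⁻¹)).1) (σ x₀ * k₀) := by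
      refine ContMDiffAt.comp (g := φ.symm) _ ?_ hf1
      rw [hτx]
      exact hφs
    exact (hf2.prodMk (hf3.mul contMDiffAt_const)).congr_of_eventuallyEq
      (hform.mono fun g hg => hg.2)
  refine ⟨A, U, fun g => (P g).1, fun g => (P g).2,
    { isOpen_param := hA
      zero_mem := h0A
      map_zero := hσ0
      isOpen_image := isOpen_iff_mem_nhds.2 fun g hg => (hloc g hg).1
      contMDiffOn := fun x hx => (hσ _ (hAS x hx _ h1Y)).contMDiffWithinAt
      contMDiffOn_fst := fun g hg =>
        (ContMDiffAt.comp g contMDiffAt_fst (hloc g hg).2).contMDiffWithinAt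
      contMDiffOn_snd := fun g hg =>
        (ContMDiffAt.comp g contMDiffAt_snd (hloc g hg).2).contMDiffWithinAt
      mul_mem := fun x hx k => ⟨(x, k), hx, rfl⟩
      fst_mul := fun x hx k => by simp only [hPeq x hx k]
      snd_mul := fun x hx k => by simp only [hPeq x hx k]
      fst_mem := fun g hg => (hP g hg).1
      mul_eq := fun g hg => (hP g hg).2 }⟩

/-- Slices exist. In charts adapted to the immersion `K → G`, with `EG = EK × F`, the map
`(x, k) ↦ σ x * k` with `σ x = (0, x)` is the identity on each of the two factors, so its
derivative at the origin is the identity. -/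
theorem exists_isGroupSlice
    (hK : Manifold.IsImmersionAtOfComplement F 𝓘(ℝ, EK) 𝓘(ℝ, EG) ∞ (Subtype.val : K → G) 1) :
    ∃ (A : Set F) (σ : F → G) (U : Set G) (ρ : G → F) (κ : G → K),
      IsGroupSlice (EG := EG) (EK := EK) K A σ U ρ κ := by
  have hGt : IsTopologicalGroup G := topologicalGroup_of_lieGroup 𝓘(ℝ, EG) ∞
  set φ := hK.domChart
  set ψ := hK.codChart
  set e := hK.equiv
  have h1φ : (1 : K) ∈ φ.source := hK.mem_domChart_source
  have h1ψ : (1 : G) ∈ ψ.source := hK.mem_codChart_source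
  have hφ : φ ∈ IsManifold.maximalAtlas 𝓘(ℝ, EK) ∞ K := hK.domChart_mem_maximalAtlas
  have hψ : ψ ∈ IsManifold.maximalAtlas 𝓘(ℝ, EG) ∞ G := hK.codChart_mem_maximalAtlas
  have hw : ∀ z ∈ φ.target, ψ (φ.symm z) = e (z, 0) := fun z hz =>
    hK.writtenInCharts (by simpa using hz)
  have hψ1 : ψ 1 = e (φ 1, 0) := by
    have := hw _ (φ.map_source h1φ)
    rwa [φ.left_inv h1φ] at this
  let σ : F → G := fun x => ψ.symm (e (φ 1, x))
  have hσ0 : σ 0 = 1 := by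
    simp only [σ, ← hψ1]
    exact ψ.left_inv h1ψ
  have hσ : ∀ x, e (φ 1, x) ∈ ψ.target → ContMDiffAt 𝓘(ℝ, F) 𝓘(ℝ, EG) ∞ σ x := by
    intro x hx
    have h2 : ContDiff ℝ ∞ (fun x : F => e (φ 1, x)) := by fun_prop
    exact ContMDiffAt.comp (g := ψ.symm) x (contMDiffAt_symm_of_mem_maximalAtlas hψ hx)
      h2.contMDiff.contMDiffAt
  let m : EK × F → G := fun p => σ p.2 * φ.symm p.1
  let f : EK × F → EG := fun p => ψ (m p)
  let W₁ : Set (EK × F) := {p | p.1 ∈ φ.target ∧ e (φ 1, p.2) ∈ ψ.target}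
  have hW₁ : IsOpen W₁ := (φ.open_target.preimage continuous_fst).inter
    (ψ.open_target.preimage (by fun_prop))
  have hm : ContMDiffOn 𝓘(ℝ, EK × F) 𝓘(ℝ, EG) ∞ m W₁ := by
    intro p hp
    have h3 : ContMDiffAt 𝓘(ℝ, EK × F) 𝓘(ℝ, EG) ∞ (fun p : EK × F => σ p.2) p :=
      ContMDiffAt.comp (g := σ) p (hσ _ hp.2) contDiff_snd.contMDiff.contMDiffAt
    have h4 : ContMDiffAt 𝓘(ℝ, EK × F) 𝓘(ℝ, EK) ∞ (fun p : EK × F => φ.symm p.1) p :=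
      ContMDiffAt.comp (g := φ.symm) p (contMDiffAt_symm_of_mem_maximalAtlas hφ hp.1)
        contDiff_fst.contMDiff.contMDiffAt
    have hv : ContMDiffAt 𝓘(ℝ, EK) 𝓘(ℝ, EG) ∞ (Subtype.val : K → G) (φ.symm p.1) := by
      have hs : φ.symm p.1 ∈ φ.source := φ.map_target hp.1
      exact hK.contMDiffOn.contMDiffAt (φ.open_source.mem_nhds hs)
    exact (h3.mul (ContMDiffAt.comp (g := (Subtype.val : K → G)) p hv h4)).contMDiffWithinAt
  let W : Set (EK × F) := W₁ ∩ m ⁻¹' ψ.source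
  have hW : IsOpen W := hm.continuousOn.isOpen_inter_preimage hW₁ ψ.open_source
  have h0m : m (φ 1, 0) = 1 := by
    simp only [m, hσ0, φ.left_inv h1φ, OneMemClass.coe_one, mul_one]
  have h0W : (φ 1, (0 : F)) ∈ W := by
    refine ⟨⟨φ.map_source h1φ, ?_⟩, ?_⟩
    · rw [← hψ1]; exact ψ.map_source h1ψ
    · rw [mem_preimage, h0m]; exact h1ψ
  have hf : ContDiffOn ℝ ∞ f W := by
    rw [← contMDiffOn_iff_contDiffOn]
    exact (contMDiffOn_of_mem_maximalAtlas hψ).comp (hm.mono inter_subset_left) fun p hp => hp.2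
  -- the partial derivatives of `f` at the origin are those of `e`
  have hfe : HasFDerivAt f (e : EK × F →L[ℝ] EG) (φ 1, 0) := by
    have hd := ((hf.contDiffAt (hW.mem_nhds h0W)).differentiableAt (by simp)).hasFDerivAt
    set D := fderiv ℝ f (φ 1, 0)
    have hl : D.comp (ContinuousLinearMap.inl ℝ EK F) =
        (e : EK × F →L[ℝ] EG).comp (ContinuousLinearMap.inl ℝ EK F) := by
      have h5 : HasFDerivAt (fun y : EK => f (y, 0)) (D.comp (ContinuousLinearMap.inl ℝ EK F))
          (φ 1) := HasFDerivAt.comp (g := f) (φ 1) hd (hasFDerivAt_prodMk_left (φ 1) (0 : F))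
      have h6 : HasFDerivAt (fun y : EK => e (y, 0))
          ((e : EK × F →L[ℝ] EG).comp (ContinuousLinearMap.inl ℝ EK F)) (φ 1) :=
        HasFDerivAt.comp (φ 1) e.hasFDerivAt (hasFDerivAt_prodMk_left (φ 1) (0 : F))
      refine h5.unique (h6.congr_of_eventuallyEq ?_)
      filter_upwards [φ.open_target.mem_nhds (φ.map_source h1φ)] with y hy
      simp only [f, m, hσ0, one_mul]
      exact hw y hy
    have hr : D.comp (ContinuousLinearMap.inr ℝ EK F) =
        (e : EK × F →L[ℝ] EG).comp (ContinuousLinearMap.inr ℝ EK F) := by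
      have h5 : HasFDerivAt (fun x : F => f (φ 1, x)) (D.comp (ContinuousLinearMap.inr ℝ EK F))
          0 := HasFDerivAt.comp (g := f) (0 : F) hd (hasFDerivAt_prodMk_right (φ 1) (0 : F))
      have h6 : HasFDerivAt (fun x : F => e (φ 1, x))
          ((e : EK × F →L[ℝ] EG).comp (ContinuousLinearMap.inr ℝ EK F)) 0 :=
        HasFDerivAt.comp (0 : F) e.hasFDerivAt (hasFDerivAt_prodMk_right (φ 1) (0 : F))
      refine h5.unique (h6.congr_of_eventuallyEq ?_)
      have hc : Continuous fun x : F => e (φ 1, x) := by fun_prop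
      filter_upwards [(ψ.open_target.preimage hc).mem_nhds h0W.1.2] with x hx
      simp only [f, m, φ.left_inv h1φ, OneMemClass.coe_one, mul_one]
      exact ψ.right_inv hx
    have hDe : D = (e : EK × F →L[ℝ] EG) := by
      ext p
      · exact DFunLike.congr_fun hl p
      · exact DFunLike.congr_fun hr p
    rwa [hDe] at hd
  have : FiniteDimensional ℝ (EK × F) := Module.Finite.equiv e.symm.toLinearEquiv
  have : CompleteSpace (EK × F) := FiniteDimensional.complete ℝ _
  obtain ⟨c, h0c, hcW, hcf, hcs⟩ := exists_openPartialHomeomorph_of_hasFDerivAt hW h0W hf hfe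
  have hcS : ∀ p ∈ c.source, m p ∈ ψ.source ∧ ψ (m p) ∈ c.target := by
    intro p hp
    refine ⟨(hcW hp).2, ?_⟩
    have := c.map_source hp
    rwa [hcf] at this
  obtain ⟨A, U, ρ, κ, h⟩ := exists_isGroupSlice_of_localInverse (σ := σ) hσ0 hφ h1φ
    c.open_source h0c
    (fun p hp => hσ _ (hcW hp).1.2)
    (ψ.isOpen_inter_preimage c.open_target) (τ := fun g => c.symm (ψ g))
    (hcs.contMDiffOn.comp ((contMDiffOn_of_mem_maximalAtlas hψ).mono inter_subset_left)
      fun g hg => hg.2)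
    (fun p hp => ⟨hcS p hp, by
      have := c.left_inv hp
      rwa [hcf] at this⟩)
    (fun g hg hp => by
      have h7 := c.right_inv hg.2
      rw [hcf] at h7
      exact ψ.injOn (hcS _ hp).1 hg.1 h7)
  exact ⟨A, σ, U, ρ, κ, h⟩

namespace IsGroupSlice

variable {A : Set F} {σ : F → G} {U : Set G} {ρ : G → F} {κ : G → K}

omit [FiniteDimensional ℝ EG] [LieGroup 𝓘(ℝ, EG) ∞ G] [LieGroup 𝓘(ℝ, EK) ∞ K] in
theorem mul_right (h : IsGroupSlice (EG := EG) (EK := EK) K A σ U ρ κ) {g : G} (hg : g ∈ U)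
    (k : K) : g * k ∈ U ∧ ρ (g * k) = ρ g ∧ κ (g * k) = κ g * k := by
  have h1 : g * k = σ (ρ g) * (κ g * k : K) := by
    rw [Subgroup.coe_mul, ← mul_assoc, h.mul_eq g hg]
  have hA := h.fst_mem g hg
  rw [h1]
  exact ⟨h.mul_mem _ hA _, h.fst_mul _ hA _, h.snd_mul _ hA _⟩

omit [FiniteDimensional ℝ EG] [LieGroup 𝓘(ℝ, EG) ∞ G] [LieGroup 𝓘(ℝ, EK) ∞ K] in
theorem apply_section (h : IsGroupSlice (EG := EG) (EK := EK) K A σ U ρ κ) {x : F} (hx : x ∈ A) :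
    σ x ∈ U ∧ ρ (σ x) = x ∧ κ (σ x) = 1 := by
  have h1 := h.mul_mem x hx 1
  have h2 := h.fst_mul x hx 1
  have h3 := h.snd_mul x hx 1
  rw [OneMemClass.coe_one, mul_one] at h1 h2 h3
  exact ⟨h1, h2, h3⟩

end IsGroupSlice

end GroupSlice

/-! ### The quotient manifold `G ×_λ H` -/

section BundleTopology

variable {G : Type*} [Group G] {K : Subgroup G} {H : Type*} [Group H]

theorem Bundle.mk_eq_mk_iff (lam : K →* H) (a b : G × H) :
    Bundle.mk lam a = Bundle.mk lam b ↔ ∃ k : K, b = (a.1 * (k : G), (lam k)⁻¹ * a.2) :=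
  ⟨fun h => Quotient.exact h, fun h => Quotient.sound h⟩

/-- The saturation of an open set is a union of translates by `K`, and so is open. -/
theorem Bundle.isOpenQuotientMap_mk [TopologicalSpace G] [TopologicalSpace H]
    [ContinuousMul G] [ContinuousMul H] (lam : K →* H) :
    IsOpenQuotientMap (Bundle.mk lam) := by
  refine ⟨Quotient.mk_surjective, continuous_quotient_mk', fun O hO => ?_⟩
  refine (isQuotientMap_quotient_mk' (s := bundleSetoid lam)).isOpen_preimage.1 ?_
  have h : (Quotient.mk (bundleSetoid lam)) ⁻¹' (Bundle.mk lam '' O) =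
      ⋃ k : K, (fun a : G × H => (a.1 * (k : G), (lam k)⁻¹ * a.2)) ⁻¹' O := by
    ext b
    simp only [mem_preimage, mem_iUnion]
    constructor
    · rintro ⟨a, ha, hab⟩
      obtain ⟨k, hk⟩ := (Bundle.mk_eq_mk_iff lam b a).1 hab.symm
      exact ⟨k, hk ▸ ha⟩
    · rintro ⟨k, hk⟩
      exact ⟨_, hk, ((Bundle.mk_eq_mk_iff lam b _).2 ⟨k, rfl⟩).symm⟩
  change IsOpen ((Quotient.mk (bundleSetoid lam)) ⁻¹' (Bundle.mk lam '' O))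
  rw [h]
  exact isOpen_iUnion fun k => hO.preimage (by fun_prop)

end BundleTopology

section BundleManifold

variable {EG : Type*} [NormedAddCommGroup EG] [NormedSpace ℝ EG]
  {G : Type*} [TopologicalSpace G] [ChartedSpace EG G] [Group G] [LieGroup 𝓘(ℝ, EG) ∞ G]
  {EH : Type*} [NormedAddCommGroup EH] [NormedSpace ℝ EH]
  {H : Type*} [TopologicalSpace H] [ChartedSpace EH H] [Group H] [LieGroup 𝓘(ℝ, EH) ∞ H]
  {EK : Type*} [NormedAddCommGroup EK] [NormedSpace ℝ EK]
  {K : Subgroup G} [ChartedSpace EK K] [LieGroup 𝓘(ℝ, EK) ∞ K]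
  {F : Type*} [NormedAddCommGroup F] [NormedSpace ℝ F]
  {F' : Type*} [NormedAddCommGroup F'] [NormedSpace ℝ F']

omit [LieGroup 𝓘(ℝ, EK) ∞ K] in
/-- Over the translate `g₀ U` of a slice neighbourhood, `(g, h) ∼ (σ (ρ g), lam (κ g) * h)` is a
normal form for `∼`, which makes `(ρ g, lam (κ g) * h)` coordinates on `P_lam`. -/
theorem exists_isSliceAt_mk {A : Set F} {σ : F → G} {U : Set G} {ρ : G → F} {κ : G → K}
    (hs : IsGroupSlice (EG := EG) (EK := EK) K A σ U ρ κ) (lam : K →* H)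
    (hlam : ContMDiff 𝓘(ℝ, EK) 𝓘(ℝ, EH) ∞ lam) (L : (F × EH) ≃L[ℝ] F') (m : G × H) :
    ∃ (O : Set (G × H)) (V : Set F') (c : G × H → F') (s : F' → G × H),
      IsSliceAt (𝓘(ℝ, EG).prod 𝓘(ℝ, EH)) (Bundle.mk lam) m O V c s := by
  obtain ⟨g₀, h₀⟩ := m
  have hGt : IsTopologicalGroup G := topologicalGroup_of_lieGroup 𝓘(ℝ, EG) ∞
  have hHt : IsTopologicalGroup H := topologicalGroup_of_lieGroup 𝓘(ℝ, EH) ∞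
  set χ := chartAt EH h₀
  have hχ : χ ∈ IsManifold.maximalAtlas 𝓘(ℝ, EH) ∞ H := IsManifold.chart_mem_maximalAtlas h₀
  let t : G × H → G := fun a => g₀⁻¹ * a.1
  have ht : ContMDiff (𝓘(ℝ, EG).prod 𝓘(ℝ, EH)) 𝓘(ℝ, EG) ∞ t :=
    contMDiff_const.mul contMDiff_fst
  let O₁ : Set (G × H) := t ⁻¹' U
  have hO₁ : IsOpen O₁ := hs.isOpen_image.preimage ht.continuous
  let w : G × H → H := fun a => lam (κ (t a)) * a.2
  have hw : ContMDiffOn (𝓘(ℝ, EG).prod 𝓘(ℝ, EH)) 𝓘(ℝ, EH) ∞ w O₁ :=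
    (hlam.comp_contMDiffOn (hs.contMDiffOn_snd.comp ht.contMDiffOn fun a ha => ha)).mul
      contMDiffOn_snd
  let O : Set (G × H) := O₁ ∩ w ⁻¹' χ.source
  let V : Set F' := L.symm ⁻¹' (A ×ˢ χ.target)
  let c : G × H → F' := fun a => L (ρ (t a), χ (w a))
  let s : F' → G × H := fun z => (g₀ * σ (L.symm z).1, χ.symm (L.symm z).2)
  have hts : ∀ z, t (s z) = σ (L.symm z).1 := fun z => inv_mul_cancel_left _ _
  have hws : ∀ z ∈ V, w (s z) = χ.symm (L.symm z).2 := by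
    intro z hz
    simp only [w, hts, (hs.apply_section hz.1).2.2, map_one, one_mul, s]
  have htm : t (g₀, h₀) = σ 0 := by rw [hs.map_zero]; exact inv_mul_cancel _
  have h0 := hs.apply_section hs.zero_mem
  have hwm : w (g₀, h₀) = h₀ := by simp only [w, htm, h0.2.2, map_one, one_mul]
  refine ⟨O, V, c, s,
    { isOpen_source := hw.continuousOn.isOpen_inter_preimage hO₁ χ.open_source
      isOpen_target := (hs.isOpen_param.prod χ.open_target).preimage L.symm.continuous
      mem_source := ⟨?_, ?_⟩
      saturated := ?_
      contMDiffOn := ?_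
      contMDiffOn_section := ?_
      mapsTo := ?_
      mapsTo_section := ?_
      right_inv := ?_
      left_inv := ?_
      section_eq := ?_ }⟩
  · change t (g₀, h₀) ∈ U
    rw [htm]
    exact h0.1
  · rw [mem_preimage, hwm]
    exact mem_chart_source EH h₀
  · rintro ⟨g, h⟩ ha b hab
    obtain ⟨k, rfl⟩ := (Bundle.mk_eq_mk_iff lam _ _).1 hab
    have ha1 : g₀⁻¹ * g ∈ U := ha.1
    obtain ⟨h1, h2, h3⟩ := hs.mul_right ha1 k
    have htk : t (g * k, (lam k)⁻¹ * h) = g₀⁻¹ * g * k := (mul_assoc _ _ _).symm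
    have hwk : w (g * k, (lam k)⁻¹ * h) = w (g, h) := by
      change lam (κ (t (g * k, (lam k)⁻¹ * h))) * ((lam k)⁻¹ * h) = lam (κ (g₀⁻¹ * g)) * h
      rw [htk, h3, map_mul, mul_assoc, mul_inv_cancel_left]
    refine ⟨⟨?_, ?_⟩, ?_⟩
    · change t (g * k, (lam k)⁻¹ * h) ∈ U
      rw [htk]
      exact h1
    · change w (g * k, (lam k)⁻¹ * h) ∈ χ.source
      rw [hwk]
      exact ha.2
    · change L (ρ (g₀⁻¹ * g), χ (w (g, h))) =
        L (ρ (t (g * k, (lam k)⁻¹ * h)), χ (w (g * k, (lam k)⁻¹ * h)))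
      rw [hwk, htk, h2]
  · have h1 : ContMDiffOn (𝓘(ℝ, EG).prod 𝓘(ℝ, EH)) 𝓘(ℝ, F) ∞ (fun a => ρ (t a)) O :=
      hs.contMDiffOn_fst.comp ht.contMDiffOn fun a ha => ha.1
    have h2 : ContMDiffOn (𝓘(ℝ, EG).prod 𝓘(ℝ, EH)) 𝓘(ℝ, EH) ∞ (fun a => χ (w a)) O :=
      (contMDiffOn_of_mem_maximalAtlas hχ).comp (hw.mono inter_subset_left) fun a ha => ha.2
    exact L.contDiff.contMDiff.comp_contMDiffOn (h1.prodMk_space h2)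
  · have h1 : ContMDiffOn 𝓘(ℝ, F') 𝓘(ℝ, EG) ∞ (fun z : F' => σ (L.symm z).1) V :=
      hs.contMDiffOn.comp
        (contDiff_fst.comp L.symm.contDiff).contMDiff.contMDiffOn fun z hz => hz.1
    have h2 : ContMDiffOn 𝓘(ℝ, F') 𝓘(ℝ, EH) ∞ (fun z : F' => χ.symm (L.symm z).2) V :=
      (contMDiffOn_symm_of_mem_maximalAtlas hχ).comp
        (contDiff_snd.comp L.symm.contDiff).contMDiff.contMDiffOn fun z hz => hz.2
    exact (contMDiffOn_const.mul h1).prodMk h2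
  · intro a ha
    change L.symm (L _) ∈ A ×ˢ χ.target
    rw [L.symm_apply_apply]
    exact ⟨hs.fst_mem _ ha.1, χ.map_source ha.2⟩
  · intro z hz
    refine ⟨?_, ?_⟩
    · change t (s z) ∈ U
      rw [hts]
      exact (hs.apply_section hz.1).1
    · rw [mem_preimage, hws z hz]
      exact χ.map_target hz.2
  · intro z hz
    change L (ρ (t (s z)), χ (w (s z))) = z
    rw [hws z hz, hts, (hs.apply_section hz.1).2.1, χ.right_inv hz.2]
    exact L.apply_symm_apply z
  · rintro ⟨g, h⟩ ha
    refine (Bundle.mk_eq_mk_iff lam _ _).2 ⟨κ (g₀⁻¹ * g), ?_⟩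
    have h1 : χ.symm (χ (w (g, h))) = w (g, h) := χ.left_inv ha.2
    simp only [s, c, L.symm_apply_apply, h1]
    refine Prod.ext ?_ ?_
    · change g = g₀ * σ (ρ (g₀⁻¹ * g)) * κ (g₀⁻¹ * g)
      rw [mul_assoc, hs.mul_eq _ ha.1, mul_inv_cancel_left]
    · change h = (lam (κ (g₀⁻¹ * g)))⁻¹ * (lam (κ (g₀⁻¹ * g)) * h)
      rw [inv_mul_cancel_left]
  · simp only [s, c, L.symm_apply_apply, hwm, htm, h0.2.1]
    rw [hs.map_zero, mul_one, χ.left_inv (mem_chart_source EH h₀)]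

/-- `P_lam` is a manifold and `G × H → P_lam` is a submersion. -/
theorem exists_isQuotientManifold [FiniteDimensional ℝ EG] [FiniteDimensional ℝ EH]
    [FiniteDimensional ℝ EK]
    (hK : Manifold.IsImmersion 𝓘(ℝ, EK) 𝓘(ℝ, EG) ∞ (Subtype.val : K → G))
    (lam : K →* H) (hlam : ContMDiff 𝓘(ℝ, EK) 𝓘(ℝ, EH) ∞ lam) :
    ∃ (_ : ChartedSpace (Model EG EK EH) (Bundle lam))
      (_ : IsManifold 𝓘(ℝ, Model EG EK EH) ∞ (Bundle lam)),
      IsQuotientManifold EG EH lam (Model EG EK EH) := by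
  have hGt : IsTopologicalGroup G := topologicalGroup_of_lieGroup 𝓘(ℝ, EG) ∞
  have hHt : IsTopologicalGroup H := topologicalGroup_of_lieGroup 𝓘(ℝ, EH) ∞
  have h1 := hK.isImmersionOfComplement_complement 1
  obtain ⟨A, σ, U, ρ, κ, hs⟩ := exists_isGroupSlice h1
  have e := h1.equiv
  have : FiniteDimensional ℝ (EK × hK.complement) := Module.Finite.equiv e.symm.toLinearEquiv
  have : FiniteDimensional ℝ hK.complement :=
    Module.Finite.of_surjective (LinearMap.snd ℝ EK hK.complement) LinearMap.snd_surjective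
  have hdim : Module.finrank ℝ EK + Module.finrank ℝ hK.complement = Module.finrank ℝ EG := by
    rw [← Module.finrank_prod, e.toLinearEquiv.finrank_eq]
  have hm : Module.finrank ℝ (Model EG EK EH) =
      Module.finrank ℝ EG - Module.finrank ℝ EK + Module.finrank ℝ EH :=
    finrank_euclideanSpace_fin
  let L : (hK.complement × EH) ≃L[ℝ] Model EG EK EH :=
    ContinuousLinearEquiv.ofFinrankEq (by rw [hm, Module.finrank_prod]; omega)
  refine exists_isSubmersion_of_isSliceAt (F' := EK) (Bundle.isOpenQuotientMap_mk lam)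
    (fun m => exists_isSliceAt_mk hs lam hlam L m) ?_
  rw [hm, Module.finrank_prod]
  omega

end BundleManifold

/-! ### Derivatives on model spaces -/

section Derivative

variable {E : Type*} [NormedAddCommGroup E] [NormedSpace ℝ E]
  {A : Type*} [TopologicalSpace A] {I : ModelWithCorners ℝ E A}
  {M : Type*} [TopologicalSpace M] [ChartedSpace A M]
  {E' : Type*} [NormedAddCommGroup E'] [NormedSpace ℝ E']
  {A' : Type*} [TopologicalSpace A'] {I' : ModelWithCorners ℝ E' A'}
  {M' : Type*} [TopologicalSpace M'] [ChartedSpace A' M']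
  {E'' : Type*} [NormedAddCommGroup E''] [NormedSpace ℝ E'']
  {A'' : Type*} [TopologicalSpace A''] {I'' : ModelWithCorners ℝ E'' A''}
  {M'' : Type*} [TopologicalSpace M''] [ChartedSpace A'' M'']

variable (I I') in
/-- The derivative of `f` at `x` as a map of model vector spaces. Unlike that of `mfderiv`, its type
does not depend on `x`, so that `x` may be rewritten. -/
def tderiv (f : M → M') (x : M) : E →L[ℝ] E' := mfderiv I I' f x

theorem tderiv_comp_apply {g : M' → M''} {f : M → M'} (hg : ContMDiff I' I'' ∞ g)
    (hf : ContMDiff I I' ∞ f) (x : M) (v : E) :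
    tderiv I' I'' g (f x) (tderiv I I' f x v) = tderiv I I'' (fun y => g (f y)) x v :=
  (DFunLike.congr_fun (mfderiv_comp x (hg.mdifferentiable (by simp) (f x))
    (hf.mdifferentiable (by simp) x)) v).symm

theorem tderiv_id_apply (x : M) (v : E) : tderiv I I (fun y : M => y) x v = v :=
  DFunLike.congr_fun (mfderiv_id (I := I) (x := x)) v

theorem tderiv_prodMk_apply {f : M → M'} {g : M → M''} (hf : ContMDiff I I' ∞ f)
    (hg : ContMDiff I I'' ∞ g) (x : M) (v : E) :
    tderiv I (I'.prod I'') (fun y => (f y, g y)) x v = (tderiv I I' f x v, tderiv I I'' g x v) :=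
  DFunLike.congr_fun (mfderiv_prodMk (hf.mdifferentiable (by simp) x)
    (hg.mdifferentiable (by simp) x)) v

theorem tderiv_const_apply (c : M') (x : M) (v : E) : tderiv I I' (fun _ : M => c) x v = 0 :=
  DFunLike.congr_fun (mfderiv_const (I := I) (I' := I') (x := x) (c := c)) v

theorem tderiv_prod_apply {f : M × M' → M''} (hf : ContMDiff (I.prod I') I'' ∞ f) (p : M × M')
    (u : E × E') :
    tderiv (I.prod I') I'' f p u =
      tderiv I I'' (fun z => f (z, p.2)) p.1 u.1 + tderiv I' I'' (fun z => f (p.1, z)) p.2 u.2 :=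
  mfderiv_prod_eq_add_apply (hf.mdifferentiable (by simp) p)

theorem tderiv_prodMap_apply {E₃ : Type*} [NormedAddCommGroup E₃] [NormedSpace ℝ E₃]
    {A₃ : Type*} [TopologicalSpace A₃] {I₃ : ModelWithCorners ℝ E₃ A₃}
    {M₃ : Type*} [TopologicalSpace M₃] [ChartedSpace A₃ M₃]
    {f : M → M''} {g : M' → M₃} (hf : ContMDiff I I'' ∞ f) (hg : ContMDiff I' I₃ ∞ g)
    (p : M × M') (u : E × E') :
    tderiv (I.prod I') (I''.prod I₃) (fun a => (f a.1, g a.2)) p u =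
      (tderiv I I'' f p.1 u.1, tderiv I' I₃ g p.2 u.2) :=
  DFunLike.congr_fun (mfderiv_prodMap (hf.mdifferentiable (by simp) p.1)
    (hg.mdifferentiable (by simp) p.2)) u

/-- If `f n` maps the base point of `g n` to a point `c` that does not depend on `n`, then the
image of the tangent vector `g n` under the derivative of `f n`, a vector at `c`, depends smoothly
on `n`. -/
theorem contMDiff_tderiv_apply [IsManifold I ∞ M] [IsManifold I' ∞ M']
    [IsManifold I'' ∞ M''] {f : M'' → M → M'}
    (hf : ContMDiff (I''.prod I) I' ∞ (Function.uncurry f)) {g : M'' → TangentBundle I M}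
    (hg : ContMDiff I'' I.tangent ∞ g) {c : M'} (hc : ∀ n, f n (g n).proj = c) :
    ContMDiff I'' 𝓘(ℝ, E') ∞ (fun n => tderiv I I' (f n) (g n).proj (g n).snd) := by
  have : IsManifold I 1 M := IsManifold.of_le (n := ∞) (by simp)
  have : IsManifold I' 1 M' := IsManifold.of_le (n := ∞) (by simp)
  have : IsManifold I'' 1 M'' := IsManifold.of_le (n := ∞) (by simp)
  intro n₀
  have hgp : ContMDiffAt I'' I ∞ (fun n => (g n).proj) n₀ :=
    ((Bundle.contMDiffAt_totalSpace ..).1 (hg n₀)).1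
  have hgv := ((Bundle.contMDiffAt_totalSpace ..).1 (hg n₀)).2
  have hA := ContMDiffAt.mfderiv f (fun n => (g n).proj) (hf (n₀, (g n₀).proj)) hgp
    (m := ∞) (by simp)
  refine (hA.clm_apply hgv).congr_of_eventuallyEq ?_
  filter_upwards [hgp.continuousAt.preimage_mem_nhds
    ((chartAt A (g n₀).proj).open_source.mem_nhds (mem_chart_source _ _))] with n hn
  have hn' : (g n).proj ∈ (chartAt A (g n₀).proj).source := hn
  have hsrc : (g n).proj ∈ (extChartAt I (g n).proj).source ∩ (extChartAt I (g n₀).proj).source :=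
    ⟨mem_extChartAt_source _, by rwa [extChartAt_source]⟩
  have h1 := inTangentCoordinates_eq (I := I) (I' := I') (fun n => (g n).proj)
    (fun n => f n (g n).proj) (fun n => tderiv I I' (f n) (g n).proj) (x₀ := n₀) (x := n) hn'
    (by simp only [hc]; exact mem_chart_source _ _)
  have h2 : ∀ v : E, tangentCoordChange I' (f n (g n).proj) (f n₀ (g n₀).proj) (f n (g n).proj)
      (tderiv I I' (f n) (g n).proj (tangentCoordChange I (g n₀).proj (g n).proj (g n).proj
        (tangentCoordChange I (g n).proj (g n₀).proj (g n).proj v))) =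
      tderiv I I' (f n) (g n).proj v := by
    intro v
    rw [tangentCoordChange_comp ⟨hsrc, mem_extChartAt_source _⟩,
      tangentCoordChange_self (mem_extChartAt_source _), hc, hc,
      tangentCoordChange_self (mem_extChartAt_source _)]
  exact ((DFunLike.congr_fun h1 _).trans (h2 (g n).snd)).symm

end Derivative

/-! ### The adjoint representation and the Maurer-Cartan form -/

section LieCalculus

variable {E : Type*} [NormedAddCommGroup E] [NormedSpace ℝ E]
  {G : Type*} [TopologicalSpace G] [ChartedSpace E G] [Group G] [LieGroup 𝓘(ℝ, E) ∞ G]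
  {E' : Type*} [NormedAddCommGroup E'] [NormedSpace ℝ E']
  {H : Type*} [TopologicalSpace H] [ChartedSpace E' H] [Group H] [LieGroup 𝓘(ℝ, E') ∞ H]

variable (E) in
/-- The adjoint representation `Ad`, on the model space of `𝔤`. -/
def modelAd (g : G) : E →L[ℝ] E := tderiv 𝓘(ℝ, E) 𝓘(ℝ, E) (fun x : G => g * x * g⁻¹) 1

theorem contMDiff_mulLeft (g : G) : ContMDiff 𝓘(ℝ, E) 𝓘(ℝ, E) ∞ (fun x : G => g * x) :=
  contMDiff_mul_left

theorem contMDiff_mulRight (g : G) : ContMDiff 𝓘(ℝ, E) 𝓘(ℝ, E) ∞ (fun x : G => x * g) :=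
  contMDiff_mul_right

theorem contMDiff_conj (g : G) : ContMDiff 𝓘(ℝ, E) 𝓘(ℝ, E) ∞ (fun x : G => g * x * g⁻¹) :=
  (contMDiff_mulRight g⁻¹).comp (contMDiff_mulLeft g)

theorem modelAd_mul_apply (g h : G) (v : E) :
    modelAd E (g * h) v = modelAd E g (modelAd E h v) := by
  have h1 := tderiv_comp_apply (contMDiff_conj (E := E) g) (contMDiff_conj (E := E) h) 1 v
  rw [mul_one, mul_inv_cancel] at h1
  refine Eq.trans ?_ h1.symm
  simp only [modelAd, mul_inv_rev, mul_assoc]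

omit [LieGroup 𝓘(ℝ, E) ∞ G] in
theorem modelAd_one_apply (v : E) : modelAd E (1 : G) v = v := by
  rw [modelAd]
  simp only [one_mul, inv_one, mul_one]
  exact tderiv_id_apply _ v

/-- The derivative of a homomorphism intertwines the adjoint representations. -/
theorem tderiv_modelAd {f : G →* H} (hf : ContMDiff 𝓘(ℝ, E) 𝓘(ℝ, E') ∞ f) (g : G) (v : E) :
    tderiv 𝓘(ℝ, E) 𝓘(ℝ, E') f 1 (modelAd E g v) =
      modelAd E' (f g) (tderiv 𝓘(ℝ, E) 𝓘(ℝ, E') f 1 v) := by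
  have h1 := tderiv_comp_apply hf (contMDiff_conj (E := E) g) 1 v
  have h2 := tderiv_comp_apply (contMDiff_conj (E := E') (f g)) hf 1 v
  simp only [mul_one, mul_inv_cancel, map_one, map_mul, map_inv] at h1 h2
  rw [modelAd, modelAd, h1, h2]

variable (E) in
/-- The left-invariant Maurer-Cartan form: the derivative at `g` of `x ↦ g⁻¹ * x`. -/
def maurerCartan (g : G) : E →L[ℝ] E := tderiv 𝓘(ℝ, E) 𝓘(ℝ, E) (fun x : G => g⁻¹ * x) g

/-- A curve `f` through `f x` is measured by the Maurer-Cartan form as the curve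
`(f x)⁻¹ * f` through `1`. -/
theorem maurerCartan_tderiv {E₀ : Type*} [NormedAddCommGroup E₀] [NormedSpace ℝ E₀]
    {A : Type*} [TopologicalSpace A] {I : ModelWithCorners ℝ E₀ A}
    {M : Type*} [TopologicalSpace M] [ChartedSpace A M] {f : M → G}
    (hf : ContMDiff I 𝓘(ℝ, E) ∞ f) (x : M) (v : E₀) :
    maurerCartan E (f x) (tderiv I 𝓘(ℝ, E) f x v) =
      tderiv I 𝓘(ℝ, E) (fun y => (f x)⁻¹ * f y) x v :=
  tderiv_comp_apply (contMDiff_mulLeft (E := E) (f x)⁻¹) hf x v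

theorem maurerCartan_mulLeft (a g : G) (v : E) :
    maurerCartan E (a * g) (tderiv 𝓘(ℝ, E) 𝓘(ℝ, E) (fun x : G => a * x) g v) =
      maurerCartan E g v := by
  have h := maurerCartan_tderiv (contMDiff_mulLeft (E := E) a) g v
  rw [h, maurerCartan]
  simp only [mul_inv_rev, mul_assoc, inv_mul_cancel_left]

omit [LieGroup 𝓘(ℝ, E) ∞ G] in
theorem maurerCartan_one (v : E) : maurerCartan E (1 : G) v = v := by
  rw [maurerCartan]
  simp only [inv_one, one_mul]
  exact tderiv_id_apply _ v

theorem maurerCartan_mulLeft_one (g : G) (v : E) :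
    maurerCartan E g (tderiv 𝓘(ℝ, E) 𝓘(ℝ, E) (fun x : G => g * x) 1 v) = v := by
  have h := maurerCartan_mulLeft (E := E) g 1 v
  rwa [mul_one, maurerCartan_one] at h

theorem mulLeft_maurerCartan (g : G) (v : E) :
    tderiv 𝓘(ℝ, E) 𝓘(ℝ, E) (fun x : G => g * x) 1 (maurerCartan E g v) = v := by
  have h := tderiv_comp_apply (contMDiff_mulLeft (E := E) g) (contMDiff_mulLeft (E := E) g⁻¹) g v
  simp only [inv_mul_cancel, mul_inv_cancel_left] at h
  exact h.trans (tderiv_id_apply _ v)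

/-- `R_k^* Θ = Ad_{k⁻¹} Θ`. -/
theorem maurerCartan_mulRight (k g : G) (v : E) :
    maurerCartan E (g * k) (tderiv 𝓘(ℝ, E) 𝓘(ℝ, E) (fun x : G => x * k) g v) =
      modelAd E k⁻¹ (maurerCartan E g v) := by
  have h1 := maurerCartan_tderiv (contMDiff_mulRight (E := E) k) g v
  have h2 := tderiv_comp_apply (contMDiff_conj (E := E) k⁻¹) (contMDiff_mulLeft (E := E) g⁻¹) g v
  rw [inv_mul_cancel] at h2
  rw [h1, modelAd, maurerCartan, h2]
  simp only [mul_inv_rev, mul_assoc, inv_inv]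

section Smooth

variable {E₀ : Type*} [NormedAddCommGroup E₀] [NormedSpace ℝ E₀]
  {A : Type*} [TopologicalSpace A] {I : ModelWithCorners ℝ E₀ A}
  {M : Type*} [TopologicalSpace M] [ChartedSpace A M] [IsManifold I ∞ M]

/-- The Maurer-Cartan form is smooth: the derivative of `x ↦ g⁻¹ * x` at `g` is a partial derivative
of the smooth map `(g, x) ↦ g⁻¹ * x`. -/
theorem contMDiff_maurerCartan {g : M → TangentBundle 𝓘(ℝ, E) G}
    (hg : ContMDiff I 𝓘(ℝ, E).tangent ∞ g) :
    ContMDiff I 𝓘(ℝ, E) ∞ (fun n => maurerCartan E (g n).proj (g n).snd) := by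
  have hp : ContMDiff I 𝓘(ℝ, E) ∞ (fun n => (g n).proj) := fun n =>
    ((Bundle.contMDiffAt_totalSpace ..).1 (hg n)).1
  have hf : ContMDiff (I.prod 𝓘(ℝ, E)) 𝓘(ℝ, E) ∞
      (Function.uncurry fun (n : M) (x : G) => (g n).proj⁻¹ * x) :=
    ((hp.comp contMDiff_fst).inv).mul contMDiff_snd
  exact contMDiff_tderiv_apply hf hg (c := (1 : G)) fun n => inv_mul_cancel _

/-- The adjoint representation is smooth. -/
theorem contMDiff_modelAd_apply {h : M → G} {y : M → E} (hh : ContMDiff I 𝓘(ℝ, E) ∞ h)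
    (hy : ContMDiff I 𝓘(ℝ, E) ∞ y) :
    ContMDiff I 𝓘(ℝ, E) ∞ (fun n => modelAd E (h n) (y n)) := by
  have hf : ContMDiff (I.prod 𝓘(ℝ, E)) 𝓘(ℝ, E) ∞
      (Function.uncurry fun (n : M) (x : G) => h n * x * (h n)⁻¹) :=
    ((hh.comp contMDiff_fst).mul contMDiff_snd).mul (hh.comp contMDiff_fst).inv
  have hg : ContMDiff I 𝓘(ℝ, E).tangent ∞
      (fun n => (⟨1, y n⟩ : TangentBundle 𝓘(ℝ, E) G)) := by
    intro n
    refine (Bundle.contMDiffAt_totalSpace ..).2 ⟨contMDiffAt_const, ?_⟩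
    refine (hy n).congr_of_eventuallyEq (Filter.Eventually.of_forall fun n' => ?_)
    exact tangentCoordChange_self (mem_extChartAt_source _)
  exact contMDiff_tderiv_apply hf hg (c := (1 : G)) fun n => by simp

end Smooth

end LieCalculus

/-! ### Descent along submersions, and the form of a Wang map -/

section Descent

variable {E : Type*} [NormedAddCommGroup E] [NormedSpace ℝ E]
  {A : Type*} [TopologicalSpace A] {I : ModelWithCorners ℝ E A} [I.Boundaryless]
  {M : Type*} [TopologicalSpace M] [ChartedSpace A M]
  {EB : Type*} [NormedAddCommGroup EB] [NormedSpace ℝ EB]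
  {B : Type*} [TopologicalSpace B] [ChartedSpace EB B]
  {V : Type*} [NormedAddCommGroup V] [NormedSpace ℝ V]

theorem tderiv_surjective_of_isSubmersion {q : M → B}
    (hq : Manifold.IsSubmersion I 𝓘(ℝ, EB) ∞ q) (a : M) :
    Function.Surjective (tderiv I 𝓘(ℝ, EB) q a) := by
  obtain ⟨s, O, hO, haO, hs, hsa, hqs⟩ := exists_section_of_isSubmersionAtOfComplement
    (hq.isSubmersionOfComplement_complement a)
  exact mfderiv_surjective_of_section (hq.contMDiff.mdifferentiable (by simp) a)
    ((hs.contMDiffAt (hO.mem_nhds haO)).mdifferentiableAt (by simp)) hsa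
    (Filter.eventually_of_mem (hO.mem_nhds haO) hqs)

/-- A map out of the target of a surjective submersion `q` is smooth if its composition with `q`
is. -/
theorem contMDiff_of_comp_isSubmersion {q : M → B} (hq : Manifold.IsSubmersion I 𝓘(ℝ, EB) ∞ q)
    (hqs : Function.Surjective q) {E' : Type*} [NormedAddCommGroup E'] [NormedSpace ℝ E']
    {A' : Type*} [TopologicalSpace A'] {I' : ModelWithCorners ℝ E' A'}
    {N : Type*} [TopologicalSpace N] [ChartedSpace A' N] {f : B → N}
    (hf : ContMDiff I I' ∞ (fun a => f (q a))) : ContMDiff 𝓘(ℝ, EB) I' ∞ f := by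
  intro p
  obtain ⟨a, rfl⟩ := hqs p
  obtain ⟨s, O, hO, haO, hs, -, hqs⟩ := exists_section_of_isSubmersionAtOfComplement
    (hq.isSubmersionOfComplement_complement a)
  refine (ContMDiffAt.comp (q a) (g := fun a => f (q a)) (hf _)
    (hs.contMDiffAt (hO.mem_nhds haO))).congr_of_eventuallyEq ?_
  filter_upwards [hO.mem_nhds haO] with b hb
  simp only [Function.comp_apply, hqs b hb]

/-- A smooth `V`-valued `1`-form `om` on `M` descends along a surjective submersion `q : M → B` if
`om u` only depends on the image of the tangent vector `u` in the tangent bundle of `B`. -/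
theorem exists_descended_form [FiniteDimensional ℝ EB] [IsManifold I ∞ M]
    [IsManifold 𝓘(ℝ, EB) ∞ B] {q : M → B}
    (hq : Manifold.IsSubmersion I 𝓘(ℝ, EB) ∞ q) (hqs : Function.Surjective q)
    {om : M → E →L[ℝ] V}
    (hom : ∀ a b u u', q a = q b → tderiv I 𝓘(ℝ, EB) q a u = tderiv I 𝓘(ℝ, EB) q b u' →
      om a u = om b u')
    (hsm : ContMDiff I.tangent 𝓘(ℝ, V) ∞ (fun v : TangentBundle I M => om v.proj v.snd)) :
    ∃ η : B → EB →L[ℝ] V, (∀ a u, η (q a) (tderiv I 𝓘(ℝ, EB) q a u) = om a u) ∧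
      ContMDiff 𝓘(ℝ, EB).tangent 𝓘(ℝ, V) ∞
        (fun v : TangentBundle 𝓘(ℝ, EB) B => η v.proj v.snd) := by
  have hM1 : IsManifold I 1 M := IsManifold.of_le (n := ∞) (by simp)
  have hB1 : IsManifold 𝓘(ℝ, EB) 1 B := IsManifold.of_le (n := ∞) (by simp)
  -- at `p`, evaluate `om` at a chosen preimage of `p`, on a linear lift of the tangent vector
  choose r hr using hqs
  have hD : ∀ a, ∃ R : EB →L[ℝ] E, ∀ w, tderiv I 𝓘(ℝ, EB) q a (R w) = w := by
    intro a
    obtain ⟨R, hR⟩ := LinearMap.exists_rightInverse_of_surjective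
      (tderiv I 𝓘(ℝ, EB) q a).toLinearMap
      (LinearMap.range_eq_top.2 (tderiv_surjective_of_isSubmersion hq a))
    exact ⟨LinearMap.toContinuousLinearMap R, fun w => LinearMap.congr_fun hR w⟩
  choose R hR using hD
  have hη : ∀ a u, (om (r (q a))).comp (R (r (q a))) (tderiv I 𝓘(ℝ, EB) q a u) = om a u :=
    fun a u => hom _ _ _ _ (hr _) (hR _ _)
  refine ⟨fun p => (om (r p)).comp (R (r p)), hη, ?_⟩
  -- by `hom`, any lift gives the same value; the tangent map of a local section lifts smoothly
  intro v₀
  obtain ⟨s, O, hO, hpO, hs, -, hqs⟩ := exists_section_of_isSubmersionAtOfComplement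
    (hq.isSubmersionOfComplement_complement (r v₀.proj))
  rw [hr] at hpO
  have hT : ContMDiffOn 𝓘(ℝ, EB).tangent I.tangent ∞ (tangentMapWithin 𝓘(ℝ, EB) I s O)
      (Bundle.TotalSpace.proj ⁻¹' O) :=
    hs.contMDiffOn_tangentMapWithin (by simp) hO.uniqueMDiffOn
  have hO' : IsOpen (Bundle.TotalSpace.proj ⁻¹' O : Set (TangentBundle 𝓘(ℝ, EB) B)) :=
    hO.preimage (FiberBundle.continuous_proj EB _)
  refine (((hsm.comp_contMDiffOn hT).congr ?_).contMDiffAt (hO'.mem_nhds hpO))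
  rintro ⟨p, w⟩ hp
  have hp' : p ∈ O := hp
  have hsp : MDifferentiableAt 𝓘(ℝ, EB) I s p :=
    (hs.contMDiffAt (hO.mem_nhds hp')).mdifferentiableAt (by simp)
  have h1 : ∀ w : EB, tderiv I 𝓘(ℝ, EB) q (s p) (tderiv 𝓘(ℝ, EB) I s p w) = w := by
    intro w
    have h2 : mfderiv 𝓘(ℝ, EB) 𝓘(ℝ, EB) (q ∘ s) p = ContinuousLinearMap.id ℝ _ := by
      rw [Filter.EventuallyEq.mfderiv_eq (f₁ := q ∘ s) (f := id)
        (Filter.eventually_of_mem (hO.mem_nhds hp') hqs), mfderiv_id]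
    rw [mfderiv_comp p (hq.contMDiff.mdifferentiable (by simp) _) hsp] at h2
    exact DFunLike.congr_fun h2 w
  have h3 : ∀ w : EB, (om (r p)).comp (R (r p)) w = om (s p) (tderiv 𝓘(ℝ, EB) I s p w) := by
    intro w
    have h4 := hη (s p) (tderiv 𝓘(ℝ, EB) I s p w)
    rwa [h1, hqs p hp'] at h4
  have h5 : mfderivWithin 𝓘(ℝ, EB) I s O p = mfderiv 𝓘(ℝ, EB) I s p :=
    mfderivWithin_of_isOpen hO hp'
  change (om (r p)).comp (R (r p)) w = om (s p) (mfderivWithin 𝓘(ℝ, EB) I s O p w)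
  rw [h5]
  exact h3 w

end Descent

section ConnectionForm

variable {EG : Type*} [NormedAddCommGroup EG] [NormedSpace ℝ EG]
  {G : Type*} [TopologicalSpace G] [ChartedSpace EG G] [Group G] [LieGroup 𝓘(ℝ, EG) ∞ G]
  {EH : Type*} [NormedAddCommGroup EH] [NormedSpace ℝ EH]
  {H : Type*} [TopologicalSpace H] [ChartedSpace EH H] [Group H] [LieGroup 𝓘(ℝ, EH) ∞ H]

/-- The form `ω_(g, h) = Ad_{h⁻¹} ∘ W ∘ Θ_G + Θ_H` on `G × H`, the pullback to `G × H` of the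
invariant connection on `P_lam` that corresponds to the Wang map `W`. -/
def wangForm (W : EG →L[ℝ] EH) (a : G × H) : EG × EH →L[ℝ] EH :=
  (modelAd EH a.2⁻¹).comp (W.comp ((maurerCartan EG a.1).comp (ContinuousLinearMap.fst ℝ EG EH))) +
    (maurerCartan EH a.2).comp (ContinuousLinearMap.snd ℝ EG EH)

omit [LieGroup 𝓘(ℝ, EG) ∞ G] [LieGroup 𝓘(ℝ, EH) ∞ H] in
theorem wangForm_apply (W : EG →L[ℝ] EH) (a : G × H) (u : EG × EH) :
    wangForm W a u =
      modelAd EH a.2⁻¹ (W (maurerCartan EG a.1 u.1)) + maurerCartan EH a.2 u.2 := rfl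

theorem contMDiff_wangForm (W : EG →L[ℝ] EH) :
    ContMDiff (𝓘(ℝ, EG).prod 𝓘(ℝ, EH)).tangent 𝓘(ℝ, EH) ∞
      (fun v : TangentBundle (𝓘(ℝ, EG).prod 𝓘(ℝ, EH)) (G × H) => wangForm W v.proj v.snd) := by
  have hG : IsManifold 𝓘(ℝ, EG) ∞ G := inferInstance
  have hH : IsManifold 𝓘(ℝ, EH) ∞ H := inferInstance
  have hG1 : IsManifold 𝓘(ℝ, EG) 1 G := IsManifold.of_le (n := ∞) (by simp)
  have hH1 : IsManifold 𝓘(ℝ, EH) 1 H := IsManifold.of_le (n := ∞) (by simp)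
  have h1 : ContMDiff (𝓘(ℝ, EG).prod 𝓘(ℝ, EH)).tangent 𝓘(ℝ, EG).tangent ∞
      (fun v : TangentBundle (𝓘(ℝ, EG).prod 𝓘(ℝ, EH)) (G × H) =>
        (⟨v.proj.1, v.snd.1⟩ : TangentBundle 𝓘(ℝ, EG) G)) :=
    contMDiff_fst.comp contMDiff_equivTangentBundleProd
  have h2 : ContMDiff (𝓘(ℝ, EG).prod 𝓘(ℝ, EH)).tangent 𝓘(ℝ, EH).tangent ∞
      (fun v : TangentBundle (𝓘(ℝ, EG).prod 𝓘(ℝ, EH)) (G × H) =>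
        (⟨v.proj.2, v.snd.2⟩ : TangentBundle 𝓘(ℝ, EH) H)) :=
    contMDiff_snd.comp contMDiff_equivTangentBundleProd
  have hp : ContMDiff (𝓘(ℝ, EG).prod 𝓘(ℝ, EH)).tangent 𝓘(ℝ, EH) ∞
      (fun v : TangentBundle (𝓘(ℝ, EG).prod 𝓘(ℝ, EH)) (G × H) => v.proj.2) :=
    fun n => ((Bundle.contMDiffAt_totalSpace ..).1 (h2 n)).1
  exact (contMDiff_modelAd_apply hp.inv
    (W.contDiff.contMDiff.comp (contMDiff_maurerCartan h1))).add (contMDiff_maurerCartan h2)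

end ConnectionForm

/-! ### The form of a Wang map is basic -/

section BundleForms

variable {EG : Type*} [NormedAddCommGroup EG] [NormedSpace ℝ EG]
  {G : Type*} [TopologicalSpace G] [ChartedSpace EG G] [Group G] [LieGroup 𝓘(ℝ, EG) ∞ G]
  {EH : Type*} [NormedAddCommGroup EH] [NormedSpace ℝ EH]
  {H : Type*} [TopologicalSpace H] [ChartedSpace EH H] [Group H] [LieGroup 𝓘(ℝ, EH) ∞ H]
  {EK : Type*} [NormedAddCommGroup EK] [NormedSpace ℝ EK]
  {K : Subgroup G} [ChartedSpace EK K] [LieGroup 𝓘(ℝ, EK) ∞ K]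
  {lam : K →* H} {W : EG →L[ℝ] EH}
  {EP : Type*} [NormedAddCommGroup EP] [NormedSpace ℝ EP] [ChartedSpace EP (Bundle lam)]

local notation "𝓘GH" =>
  ModelWithCorners.prod (modelWithCornersSelf ℝ EG) (modelWithCornersSelf ℝ EH)

omit [LieGroup 𝓘(ℝ, EK) ∞ K] [ChartedSpace EK K] [ChartedSpace EP (Bundle lam)] in
/-- The form `wangForm W` is invariant under the action of `K` whose quotient is `P_lam`. -/
theorem wangForm_orbit
    (hW : ∀ (k : K) (v : EG), W (modelAd EG (k : G) v) = modelAd EH (lam k) (W v))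
    (k : K) (a : G × H) (u : EG × EH) :
    wangForm W (a.1 * (k : G), (lam k)⁻¹ * a.2)
      (tderiv 𝓘(ℝ, EG) 𝓘(ℝ, EG) (fun x : G => x * k) a.1 u.1,
        tderiv 𝓘(ℝ, EH) 𝓘(ℝ, EH) (fun x : H => (lam k)⁻¹ * x) a.2 u.2) = wangForm W a u := by
  rw [wangForm_apply, wangForm_apply]
  dsimp only
  rw [maurerCartan_mulRight, maurerCartan_mulLeft]
  have h := hW k⁻¹ (maurerCartan EG a.1 u.1)
  rw [Subgroup.coe_inv] at h
  rw [h, map_inv, mul_inv_rev, inv_inv, modelAd_mul_apply, ← modelAd_mul_apply (lam k),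
    mul_inv_cancel, modelAd_one_apply]

omit [LieGroup 𝓘(ℝ, EK) ∞ K] in
/-- The tangent vectors of the `K`-orbits: since `[g k, h] = [g, lam(k) h]`, the vector
`(dL_g x, -dR_h (lam_* x))` is vertical for `G × H → P_lam`. -/
theorem tderiv_mk_orbit (hmk : ContMDiff 𝓘GH 𝓘(ℝ, EP) ∞ (Bundle.mk lam))
    (hK : ContMDiff 𝓘(ℝ, EK) 𝓘(ℝ, EG) ∞ (Subtype.val : K → G))
    (hlam : ContMDiff 𝓘(ℝ, EK) 𝓘(ℝ, EH) ∞ lam) (a : G × H) (x : EK) :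
    tderiv 𝓘GH 𝓘(ℝ, EP) (Bundle.mk lam) a
      (tderiv 𝓘(ℝ, EG) 𝓘(ℝ, EG) (fun y : G => a.1 * y) 1
        (tderiv 𝓘(ℝ, EK) 𝓘(ℝ, EG) (Subtype.val : K → G) 1 x),
      -tderiv 𝓘(ℝ, EH) 𝓘(ℝ, EH) (fun y : H => y * a.2) 1 (tderiv 𝓘(ℝ, EK) 𝓘(ℝ, EH) lam 1 x)) =
      0 := by
  obtain ⟨g, h⟩ := a
  have hα : ContMDiff 𝓘(ℝ, EK) 𝓘(ℝ, EG) ∞ (fun k : K => g * (k : G)) := contMDiff_const.mul hK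
  have hβ : ContMDiff 𝓘(ℝ, EK) 𝓘(ℝ, EH) ∞ (fun k : K => lam k * h) := hlam.mul contMDiff_const
  have hg : ContMDiff 𝓘(ℝ, EK) 𝓘(ℝ, EG) ∞ (fun _ : K => g) := contMDiff_const
  have hh : ContMDiff 𝓘(ℝ, EK) 𝓘(ℝ, EH) ∞ (fun _ : K => h) := contMDiff_const
  have h1 := tderiv_comp_apply hmk (hα.prodMk hh) 1 x
  have h2 := tderiv_comp_apply hmk (hg.prodMk hβ) 1 x
  have h3 : (fun k : K => Bundle.mk lam (g * (k : G), h)) =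
      fun k : K => Bundle.mk lam (g, lam k * h) := by
    funext k
    exact (Bundle.mk_eq_mk_iff lam _ _).2 ⟨k⁻¹, by simp⟩
  rw [h3, ← h2, tderiv_prodMk_apply hα hh, tderiv_prodMk_apply hg hβ,
    tderiv_const_apply, tderiv_const_apply, OneMemClass.coe_one, mul_one, map_one, one_mul,
    ← sub_eq_zero, ← map_sub, Prod.mk_sub_mk, sub_zero, zero_sub] at h1
  have h4 := tderiv_comp_apply (contMDiff_mulLeft (E := EG) g) hK 1 x
  have h5 := tderiv_comp_apply (contMDiff_mulRight (E := EH) h) hlam 1 x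
  rw [OneMemClass.coe_one] at h4
  rw [map_one] at h5
  dsimp only
  rw [h4, h5]
  exact h1

omit [LieGroup 𝓘(ℝ, EK) ∞ K] in
/-- By a count of dimensions, the kernel of the derivative of `G × H → P_lam` consists of the
tangent vectors of the `K`-orbits, and these are killed by `wangForm W`. -/
theorem wangForm_eq_zero [FiniteDimensional ℝ EG] [FiniteDimensional ℝ EH] [FiniteDimensional ℝ EK]
    [FiniteDimensional ℝ EP]
    (hdim : Module.finrank ℝ EP + Module.finrank ℝ EK =
      Module.finrank ℝ EG + Module.finrank ℝ EH)
    (hmk : Manifold.IsSubmersion 𝓘GH 𝓘(ℝ, EP) ∞ (Bundle.mk lam))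
    (hK : ContMDiff 𝓘(ℝ, EK) 𝓘(ℝ, EG) ∞ (Subtype.val : K → G))
    (hKinj : Function.Injective (tderiv 𝓘(ℝ, EK) 𝓘(ℝ, EG) (Subtype.val : K → G) 1))
    (hlam : ContMDiff 𝓘(ℝ, EK) 𝓘(ℝ, EH) ∞ lam)
    (hW : ∀ x : EK, W (tderiv 𝓘(ℝ, EK) 𝓘(ℝ, EG) (Subtype.val : K → G) 1 x) =
      tderiv 𝓘(ℝ, EK) 𝓘(ℝ, EH) lam 1 x)
    {a : G × H} {u : EG × EH} (hu : tderiv 𝓘GH 𝓘(ℝ, EP) (Bundle.mk lam) a u = 0) :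
    wangForm W a u = 0 := by
  let J : EK →ₗ[ℝ] EG × EH := LinearMap.prod
    ((tderiv 𝓘(ℝ, EG) 𝓘(ℝ, EG) (fun y : G => a.1 * y) 1).comp
      (tderiv 𝓘(ℝ, EK) 𝓘(ℝ, EG) (Subtype.val : K → G) 1)).toLinearMap
    (-((tderiv 𝓘(ℝ, EH) 𝓘(ℝ, EH) (fun y : H => y * a.2) 1).comp
      (tderiv 𝓘(ℝ, EK) 𝓘(ℝ, EH) lam 1)).toLinearMap)
  have hJ : Function.Injective J := by
    intro x y hxy
    have h1 := congrArg (fun p => maurerCartan EG a.1 p.1) hxy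
    change maurerCartan EG a.1 (tderiv 𝓘(ℝ, EG) 𝓘(ℝ, EG) (fun y : G => a.1 * y) 1 _) =
      maurerCartan EG a.1 (tderiv 𝓘(ℝ, EG) 𝓘(ℝ, EG) (fun y : G => a.1 * y) 1 _) at h1
    rw [maurerCartan_mulLeft_one, maurerCartan_mulLeft_one] at h1
    exact hKinj h1
  set D := (tderiv 𝓘GH 𝓘(ℝ, EP) (Bundle.mk lam) a).toLinearMap
  have hle : LinearMap.range J ≤ LinearMap.ker D := by
    rintro _ ⟨x, rfl⟩
    exact tderiv_mk_orbit hmk.contMDiff hK hlam a x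
  have hfr : Module.finrank ℝ (LinearMap.range J) = Module.finrank ℝ (LinearMap.ker D) := by
    have h1 := D.finrank_range_add_finrank_ker
    rw [LinearMap.range_eq_top.2 (tderiv_surjective_of_isSubmersion hmk a), finrank_top,
      Module.finrank_prod] at h1
    rw [LinearMap.finrank_range_of_inj hJ]
    omega
  have hu' : u ∈ LinearMap.range J := by
    rw [Submodule.eq_of_le_of_finrank_eq hle hfr]
    exact hu
  obtain ⟨x, rfl⟩ := hu'
  have h1 : maurerCartan EH a.2 (tderiv 𝓘(ℝ, EH) 𝓘(ℝ, EH) (fun y : H => y * a.2) 1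
      (tderiv 𝓘(ℝ, EK) 𝓘(ℝ, EH) lam 1 x)) =
      modelAd EH a.2⁻¹ (tderiv 𝓘(ℝ, EK) 𝓘(ℝ, EH) lam 1 x) := by
    have h2 := maurerCartan_mulRight (E := EH) a.2 1 (tderiv 𝓘(ℝ, EK) 𝓘(ℝ, EH) lam 1 x)
    rwa [one_mul, maurerCartan_one] at h2
  change modelAd EH a.2⁻¹ (W (maurerCartan EG a.1 (tderiv 𝓘(ℝ, EG) 𝓘(ℝ, EG)
    (fun y : G => a.1 * y) 1 (tderiv 𝓘(ℝ, EK) 𝓘(ℝ, EG) (Subtype.val : K → G) 1 x)))) +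
    maurerCartan EH a.2 (-(tderiv 𝓘(ℝ, EH) 𝓘(ℝ, EH) (fun y : H => y * a.2) 1
      (tderiv 𝓘(ℝ, EK) 𝓘(ℝ, EH) lam 1 x))) = 0
  rw [maurerCartan_mulLeft_one, hW, map_neg, h1, add_neg_cancel]

omit [LieGroup 𝓘(ℝ, EK) ∞ K] in
/-- The form `wangForm W` of a Wang map `W` descends to `P_lam`. -/
theorem exists_form_of_isWangMap [FiniteDimensional ℝ EG] [FiniteDimensional ℝ EH]
    [FiniteDimensional ℝ EK] [FiniteDimensional ℝ EP] [IsManifold 𝓘(ℝ, EP) ∞ (Bundle lam)]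
    (hdim : Module.finrank ℝ EP + Module.finrank ℝ EK =
      Module.finrank ℝ EG + Module.finrank ℝ EH)
    (hmk : Manifold.IsSubmersion 𝓘GH 𝓘(ℝ, EP) ∞ (Bundle.mk lam))
    (hK : ContMDiff 𝓘(ℝ, EK) 𝓘(ℝ, EG) ∞ (Subtype.val : K → G))
    (hKinj : Function.Injective (tderiv 𝓘(ℝ, EK) 𝓘(ℝ, EG) (Subtype.val : K → G) 1))
    (hlam : ContMDiff 𝓘(ℝ, EK) 𝓘(ℝ, EH) ∞ lam)
    (hW : ∀ x : EK, W (tderiv 𝓘(ℝ, EK) 𝓘(ℝ, EG) (Subtype.val : K → G) 1 x) =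
      tderiv 𝓘(ℝ, EK) 𝓘(ℝ, EH) lam 1 x)
    (hWAd : ∀ (k : K) (v : EG), W (modelAd EG (k : G) v) = modelAd EH (lam k) (W v)) :
    ∃ η : Bundle lam → EP →L[ℝ] EH,
      (∀ a u, η (Bundle.mk lam a) (tderiv 𝓘GH 𝓘(ℝ, EP) (Bundle.mk lam) a u) = wangForm W a u) ∧
      ContMDiff 𝓘(ℝ, EP).tangent 𝓘(ℝ, EH) ∞
        (fun v : TangentBundle 𝓘(ℝ, EP) (Bundle lam) => η v.proj v.snd) := by
  -- the vector `u` moved by `k` to the point of `u'` differs from `u'` by a vertical vector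
  refine exists_descended_form hmk Quotient.mk_surjective ?_ (contMDiff_wangForm W)
  intro a b u u' hab huu
  obtain ⟨k, rfl⟩ := (Bundle.mk_eq_mk_iff lam _ _).1 hab
  have h1 : ContMDiff 𝓘GH 𝓘(ℝ, EG) ∞ (fun b : G × H => b.1 * (k : G)) :=
    (contMDiff_mulRight (k : G)).comp contMDiff_fst
  have h2 : ContMDiff 𝓘GH 𝓘(ℝ, EH) ∞ (fun b : G × H => (lam k)⁻¹ * b.2) :=
    (contMDiff_mulLeft (lam k)⁻¹).comp contMDiff_snd
  have h3 := tderiv_comp_apply hmk.contMDiff (h1.prodMk h2) a u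
  have h4 : (fun b : G × H => Bundle.mk lam (b.1 * (k : G), (lam k)⁻¹ * b.2)) =
      Bundle.mk lam :=
    funext fun b => ((Bundle.mk_eq_mk_iff lam _ _).2 ⟨k, rfl⟩).symm
  have h5 : tderiv 𝓘GH 𝓘GH (fun b : G × H => (b.1 * (k : G), (lam k)⁻¹ * b.2)) a u =
      (tderiv 𝓘(ℝ, EG) 𝓘(ℝ, EG) (fun x : G => x * k) a.1 u.1,
        tderiv 𝓘(ℝ, EH) 𝓘(ℝ, EH) (fun x : H => (lam k)⁻¹ * x) a.2 u.2) :=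
    tderiv_prodMap_apply (contMDiff_mulRight (k : G)) (contMDiff_mulLeft (lam k)⁻¹) a u
  rw [h4, h5] at h3
  rw [← wangForm_orbit hWAd k a u, ← sub_eq_zero, ← map_sub]
  refine wangForm_eq_zero hdim hmk hK hKinj hlam hW ?_
  rw [map_sub, h3, huu, sub_self]

end BundleForms

/-! ### Invariant connections and their pullbacks -/

section Connection

variable {EG : Type*} [NormedAddCommGroup EG] [NormedSpace ℝ EG]
  {G : Type*} [TopologicalSpace G] [ChartedSpace EG G] [Group G] [LieGroup 𝓘(ℝ, EG) ∞ G]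
  {EH : Type*} [NormedAddCommGroup EH] [NormedSpace ℝ EH]
  {H : Type*} [TopologicalSpace H] [ChartedSpace EH H] [Group H] [LieGroup 𝓘(ℝ, EH) ∞ H]
  {K : Subgroup G} {lam : K →* H} {W : EG →L[ℝ] EH}
  {EP : Type*} [NormedAddCommGroup EP] [NormedSpace ℝ EP] [ChartedSpace EP (Bundle lam)]

local notation "𝓘GH" =>
  ModelWithCorners.prod (modelWithCornersSelf ℝ EG) (modelWithCornersSelf ℝ EH)

omit [LieGroup 𝓘(ℝ, EG) ∞ G] [LieGroup 𝓘(ℝ, EH) ∞ H] in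
theorem contMDiff_mk_left (hmk : ContMDiff 𝓘GH 𝓘(ℝ, EP) ∞ (Bundle.mk lam)) (h : H) :
    ContMDiff 𝓘(ℝ, EG) 𝓘(ℝ, EP) ∞ (fun g : G => Bundle.mk lam (g, h)) :=
  hmk.comp (contMDiff_id.prodMk contMDiff_const)

omit [LieGroup 𝓘(ℝ, EG) ∞ G] [LieGroup 𝓘(ℝ, EH) ∞ H] in
theorem contMDiff_mk_right (hmk : ContMDiff 𝓘GH 𝓘(ℝ, EP) ∞ (Bundle.mk lam)) (g : G) :
    ContMDiff 𝓘(ℝ, EH) 𝓘(ℝ, EP) ∞ (fun h : H => Bundle.mk lam (g, h)) :=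
  hmk.comp (contMDiff_const.prodMk contMDiff_id)

omit [LieGroup 𝓘(ℝ, EG) ∞ G] in
theorem contMDiff_right (hmk : Manifold.IsSubmersion 𝓘GH 𝓘(ℝ, EP) ∞ (Bundle.mk lam)) (h : H) :
    ContMDiff 𝓘(ℝ, EP) 𝓘(ℝ, EP) ∞ (fun p : Bundle lam => Bundle.right lam p h) :=
  contMDiff_of_comp_isSubmersion hmk Quotient.mk_surjective
    (hmk.contMDiff.comp (contMDiff_fst.prodMk ((contMDiff_mulRight h).comp contMDiff_snd)))

omit [LieGroup 𝓘(ℝ, EH) ∞ H] in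
theorem contMDiff_left (hmk : Manifold.IsSubmersion 𝓘GH 𝓘(ℝ, EP) ∞ (Bundle.mk lam)) (g : G) :
    ContMDiff 𝓘(ℝ, EP) 𝓘(ℝ, EP) ∞ (Bundle.left lam g) :=
  contMDiff_of_comp_isSubmersion hmk Quotient.mk_surjective
    (hmk.contMDiff.comp (((contMDiff_mulLeft g).comp contMDiff_fst).prodMk contMDiff_snd))

omit [TopologicalSpace G] [ChartedSpace EG G] [LieGroup 𝓘(ℝ, EG) ∞ G] [TopologicalSpace H]
  [ChartedSpace EH H] [LieGroup 𝓘(ℝ, EH) ∞ H] in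
theorem Bundle.right_mk (a : G × H) (h : H) :
    Bundle.right lam (Bundle.mk lam a) h = Bundle.mk lam (a.1, a.2 * h) := rfl

omit [TopologicalSpace G] [ChartedSpace EG G] [LieGroup 𝓘(ℝ, EG) ∞ G] [TopologicalSpace H]
  [ChartedSpace EH H] [LieGroup 𝓘(ℝ, EH) ∞ H] in
theorem Bundle.left_mk (g : G) (a : G × H) :
    Bundle.left lam g (Bundle.mk lam a) = Bundle.mk lam (g * a.1, a.2) := rfl

omit [LieGroup 𝓘(ℝ, EG) ∞ G] in
/-- A form whose pullback to `G × H` is `wangForm W` is a connection form. -/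
theorem isConnection_of_pullback_eq_wangForm [IsManifold 𝓘(ℝ, EP) ∞ (Bundle lam)]
    (hmk : Manifold.IsSubmersion 𝓘GH 𝓘(ℝ, EP) ∞ (Bundle.mk lam))
    {η : Bundle lam → EP →L[ℝ] EH}
    (hη : ∀ a u, η (Bundle.mk lam a) (tderiv 𝓘GH 𝓘(ℝ, EP) (Bundle.mk lam) a u) = wangForm W a u)
    (hsm : ContMDiff 𝓘(ℝ, EP).tangent 𝓘(ℝ, EH) ∞
      (fun v : TangentBundle 𝓘(ℝ, EP) (Bundle lam) => η v.proj v.snd)) :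
    IsConnection (EH := EH) (H := H) (Bundle.right lam) (η : LieForm EP (Bundle lam) EH H) where
  smooth := hsm
  equivariant := by
    intro h p
    obtain ⟨a, rfl⟩ := Quotient.mk_surjective p
    change ∀ v : EP, η (Bundle.mk lam (a.1, a.2 * h)) (tderiv 𝓘(ℝ, EP) 𝓘(ℝ, EP)
      (fun p => Bundle.right lam p h) (Bundle.mk lam a) v) =
      modelAd EH h⁻¹ (η (Bundle.mk lam a) v)
    intro v
    obtain ⟨u, rfl⟩ := tderiv_surjective_of_isSubmersion hmk a v
    have hr : ContMDiff 𝓘GH 𝓘GH ∞ (fun b : G × H => (b.1, b.2 * h)) :=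
      contMDiff_fst.prodMk ((contMDiff_mulRight h).comp contMDiff_snd)
    have h1 := tderiv_comp_apply hmk.contMDiff hr a u
    have h2 : tderiv 𝓘GH 𝓘GH (fun b : G × H => (b.1, b.2 * h)) a u =
        (tderiv 𝓘(ℝ, EG) 𝓘(ℝ, EG) (fun x : G => x) a.1 u.1,
          tderiv 𝓘(ℝ, EH) 𝓘(ℝ, EH) (fun x : H => x * h) a.2 u.2) :=
      tderiv_prodMap_apply contMDiff_id (contMDiff_mulRight h) a u
    rw [h2, tderiv_id_apply] at h1
    rw [tderiv_comp_apply (contMDiff_right hmk h) hmk.contMDiff]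
    simp only [Bundle.right_mk]
    rw [← h1, hη, hη, wangForm_apply, wangForm_apply]
    dsimp only
    rw [maurerCartan_mulRight, mul_inv_rev, modelAd_mul_apply, map_add]
  fundamental := by
    intro p
    obtain ⟨a, rfl⟩ := Quotient.mk_surjective p
    change ∀ y : EH, η (Bundle.mk lam (a.1, a.2 * 1)) (tderiv 𝓘(ℝ, EH) 𝓘(ℝ, EP)
      (fun h => Bundle.mk lam (a.1, a.2 * h)) 1 y) = y
    intro y
    have hg : ContMDiff 𝓘(ℝ, EH) 𝓘(ℝ, EG) ∞ (fun _ : H => a.1) := contMDiff_const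
    have h1 := tderiv_comp_apply hmk.contMDiff (hg.prodMk (contMDiff_mulLeft a.2)) 1 y
    rw [tderiv_prodMk_apply hg (contMDiff_mulLeft a.2), tderiv_const_apply] at h1
    rw [← h1, hη, wangForm_apply]
    dsimp only
    rw [map_zero, map_zero, map_zero, zero_add, mul_one, maurerCartan_mulLeft_one]

omit [LieGroup 𝓘(ℝ, EH) ∞ H] in
/-- A form whose pullback to `G × H` is `wangForm W` is `G`-invariant. -/
theorem isInvariant_of_pullback_eq_wangForm
    (hmk : Manifold.IsSubmersion 𝓘GH 𝓘(ℝ, EP) ∞ (Bundle.mk lam))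
    {η : Bundle lam → EP →L[ℝ] EH}
    (hη : ∀ a u, η (Bundle.mk lam a) (tderiv 𝓘GH 𝓘(ℝ, EP) (Bundle.mk lam) a u) =
      wangForm W a u) :
    IsInvariant (EH := EH) (H := H) (Bundle.left lam) (η : LieForm EP (Bundle lam) EH H) := by
  intro g p
  obtain ⟨a, rfl⟩ := Quotient.mk_surjective p
  change ∀ v : EP, η (Bundle.mk lam (g * a.1, a.2)) (tderiv 𝓘(ℝ, EP) 𝓘(ℝ, EP)
    (Bundle.left lam g) (Bundle.mk lam a) v) = η (Bundle.mk lam a) v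
  intro v
  obtain ⟨u, rfl⟩ := tderiv_surjective_of_isSubmersion hmk a v
  have hl : ContMDiff 𝓘GH 𝓘GH ∞ (fun b : G × H => (g * b.1, b.2)) :=
    ((contMDiff_mulLeft g).comp contMDiff_fst).prodMk contMDiff_snd
  have h1 := tderiv_comp_apply hmk.contMDiff hl a u
  have h2 : tderiv 𝓘GH 𝓘GH (fun b : G × H => (g * b.1, b.2)) a u =
      (tderiv 𝓘(ℝ, EG) 𝓘(ℝ, EG) (fun x : G => g * x) a.1 u.1,
        tderiv 𝓘(ℝ, EH) 𝓘(ℝ, EH) (fun x : H => x) a.2 u.2) :=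
    tderiv_prodMap_apply (contMDiff_mulLeft g) contMDiff_id a u
  rw [h2, tderiv_id_apply] at h1
  rw [tderiv_comp_apply (contMDiff_left hmk g) hmk.contMDiff]
  simp only [Bundle.left_mk]
  rw [← h1, hη, hη, wangForm_apply, wangForm_apply]
  dsimp only
  rw [maurerCartan_mulLeft]

omit [LieGroup 𝓘(ℝ, EG) ∞ G] [LieGroup 𝓘(ℝ, EH) ∞ H] in
theorem pullback_section_of_pullback_eq_wangForm
    (hmk : ContMDiff 𝓘GH 𝓘(ℝ, EP) ∞ (Bundle.mk lam)) {η : Bundle lam → EP →L[ℝ] EH}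
    (hη : ∀ a u, η (Bundle.mk lam a) (tderiv 𝓘GH 𝓘(ℝ, EP) (Bundle.mk lam) a u) =
      wangForm W a u) (g : G) (v : EG) :
    η (Bundle.mk lam (g, 1)) (tderiv 𝓘(ℝ, EG) 𝓘(ℝ, EP) (fun x => Bundle.mk lam (x, 1)) g v) =
      W (maurerCartan EG g v) := by
  have hi : ContMDiff 𝓘(ℝ, EG) 𝓘(ℝ, EG) ∞ (fun x : G => x) := contMDiff_id
  have hc : ContMDiff 𝓘(ℝ, EG) 𝓘(ℝ, EH) ∞ (fun _ : G => (1 : H)) := contMDiff_const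
  have h1 := tderiv_comp_apply hmk (hi.prodMk hc) g v
  rw [tderiv_prodMk_apply hi hc, tderiv_const_apply, tderiv_id_apply] at h1
  rw [← h1, hη, wangForm_apply]
  dsimp only
  rw [map_zero, add_zero, inv_one, modelAd_one_apply]

omit [LieGroup 𝓘(ℝ, EG) ∞ G] in
/-- A connection form on `P_lam` is determined by its pullback along `g ↦ [g, 1]`: if that is
`W ∘ Θ_G`, then its pullback to `G × H` is `wangForm W`. -/
theorem pullback_eq_wangForm [IsManifold 𝓘(ℝ, EP) ∞ (Bundle lam)]
    (hmk : Manifold.IsSubmersion 𝓘GH 𝓘(ℝ, EP) ∞ (Bundle.mk lam))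
    {η : Bundle lam → EP →L[ℝ] EH}
    (hη : IsConnection (EH := EH) (H := H) (Bundle.right lam) (η : LieForm EP (Bundle lam) EH H))
    (hW : ∀ (g : G) (v : EG), η (Bundle.mk lam (g, 1))
      (tderiv 𝓘(ℝ, EG) 𝓘(ℝ, EP) (fun x => Bundle.mk lam (x, 1)) g v) = W (maurerCartan EG g v))
    (a : G × H) (u : EG × EH) :
    η (Bundle.mk lam a) (tderiv 𝓘GH 𝓘(ℝ, EP) (Bundle.mk lam) a u) = wangForm W a u := by
  obtain ⟨g, h⟩ := a
  obtain ⟨v, w⟩ := u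
  rw [tderiv_prod_apply hmk.contMDiff, map_add, wangForm_apply]
  dsimp only
  -- equivariance gives the values on vectors along `G`, the fundamental fields those along `H`
  congr 1
  · have h1 : η (Bundle.mk lam (g, 1 * h)) (tderiv 𝓘(ℝ, EP) 𝓘(ℝ, EP)
        (fun p => Bundle.right lam p h) (Bundle.mk lam (g, 1))
        (tderiv 𝓘(ℝ, EG) 𝓘(ℝ, EP) (fun x => Bundle.mk lam (x, 1)) g v)) =
        modelAd EH h⁻¹ (η (Bundle.mk lam (g, 1))
          (tderiv 𝓘(ℝ, EG) 𝓘(ℝ, EP) (fun x => Bundle.mk lam (x, 1)) g v)) :=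
      hη.equivariant h (Bundle.mk lam (g, 1)) _
    rw [tderiv_comp_apply (contMDiff_right hmk h) (contMDiff_mk_left hmk.contMDiff 1), hW] at h1
    simp only [Bundle.right_mk, one_mul] at h1
    exact h1
  · have h1 : η (Bundle.mk lam (g, h * 1)) (tderiv 𝓘(ℝ, EH) 𝓘(ℝ, EP)
        (fun x => Bundle.mk lam (g, h * x)) 1 (maurerCartan EH h w)) = maurerCartan EH h w :=
      hη.fundamental (Bundle.mk lam (g, h)) _
    have h2 := tderiv_comp_apply (contMDiff_mk_right hmk.contMDiff g) (contMDiff_mulLeft h) 1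
      (maurerCartan EH h w)
    rwa [← h2, mulLeft_maurerCartan, mul_one] at h1

omit [LieGroup 𝓘(ℝ, EH) ∞ H] in
/-- An invariant form that is `W` on the vectors `x*` at `[1, 1]` pulls back to `W ∘ Θ_G` along
`g ↦ [g, 1]`. -/
theorem pullback_section_of_isInvariant
    (hmk : Manifold.IsSubmersion 𝓘GH 𝓘(ℝ, EP) ∞ (Bundle.mk lam))
    {η : Bundle lam → EP →L[ℝ] EH}
    (hη : IsInvariant (EH := EH) (H := H) (Bundle.left lam) (η : LieForm EP (Bundle lam) EH H))
    (hW : IsAssociated lam (W : EG →ₗ[ℝ] EH) (η : LieForm EP (Bundle lam) EH H))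
    (g : G) (v : EG) :
    η (Bundle.mk lam (g, 1)) (tderiv 𝓘(ℝ, EG) 𝓘(ℝ, EP) (fun x => Bundle.mk lam (x, 1)) g v) =
      W (maurerCartan EG g v) := by
  have h1 : η (Bundle.mk lam (1 * 1, 1)) (tderiv 𝓘(ℝ, EG) 𝓘(ℝ, EP)
      (fun x => Bundle.mk lam (x * 1, 1)) 1 (maurerCartan EG g v)) = W (maurerCartan EG g v) :=
    hW (maurerCartan EG g v)
  simp only [mul_one] at h1
  have h2 : η (Bundle.mk lam (g * 1, 1)) (tderiv 𝓘(ℝ, EP) 𝓘(ℝ, EP) (Bundle.left lam g)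
      (Bundle.mk lam (1, 1)) (tderiv 𝓘(ℝ, EG) 𝓘(ℝ, EP) (fun x => Bundle.mk lam (x, 1)) 1
        (maurerCartan EG g v))) = η (Bundle.mk lam (1, 1))
      (tderiv 𝓘(ℝ, EG) 𝓘(ℝ, EP) (fun x => Bundle.mk lam (x, 1)) 1 (maurerCartan EG g v)) :=
    hη g (Bundle.mk lam (1, 1)) _
  have h3 := tderiv_comp_apply (contMDiff_mk_left hmk.contMDiff 1) (contMDiff_mulLeft g) 1
    (maurerCartan EG g v)
  rw [h1, mul_one, tderiv_comp_apply (contMDiff_left hmk g) (contMDiff_mk_left hmk.contMDiff 1)]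
    at h2
  simp only [Bundle.left_mk] at h2
  rwa [← h3, mulLeft_maurerCartan, mul_one] at h2

omit [LieGroup 𝓘(ℝ, EG) ∞ G] [LieGroup 𝓘(ℝ, EH) ∞ H] in
/-- Forms on `P_lam` with the same pullback to `G × H` are equal. -/
theorem form_ext_of_pullback (hmk : Manifold.IsSubmersion 𝓘GH 𝓘(ℝ, EP) ∞ (Bundle.mk lam))
    {η η' : Bundle lam → EP →L[ℝ] EH}
    (h : ∀ a u, η (Bundle.mk lam a) (tderiv 𝓘GH 𝓘(ℝ, EP) (Bundle.mk lam) a u) =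
      η' (Bundle.mk lam a) (tderiv 𝓘GH 𝓘(ℝ, EP) (Bundle.mk lam) a u)) : η = η' := by
  funext p
  obtain ⟨a, rfl⟩ := Quotient.mk_surjective p
  ext v
  obtain ⟨u, rfl⟩ := tderiv_surjective_of_isSubmersion hmk a v
  exact h a u

end Connection

/-! ### Canonical maps and the Maurer-Cartan form of a reductive decomposition -/

section WangMaps

variable {EG : Type*} [NormedAddCommGroup EG] [NormedSpace ℝ EG]
  {G : Type*} [TopologicalSpace G] [ChartedSpace EG G] [Group G]
  {EH : Type*} [NormedAddCommGroup EH] [NormedSpace ℝ EH]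
  {H : Type*} [TopologicalSpace H] [ChartedSpace EH H] [Group H]
  {EK : Type*} [NormedAddCommGroup EK] [NormedSpace ℝ EK]
  {K : Subgroup G} [ChartedSpace EK K]
  {lam : K →* H} {s : Submodule ℝ (GroupLieAlgebra 𝓘(ℝ, EG) G)}

theorem exists_eq_add_of_isCompl
    (hs : IsCompl (LinearMap.range (inclLie (EG := EG) (EK := EK) K).toLinearMap) s)
    (v : GroupLieAlgebra 𝓘(ℝ, EG) G) :
    ∃ x : GroupLieAlgebra 𝓘(ℝ, EK) K, ∃ w ∈ s, v = inclLie (EG := EG) (EK := EK) K x + w := by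
  have hv : v ∈ LinearMap.range (inclLie (EG := EG) (EK := EK) K).toLinearMap ⊔ s := by
    rw [hs.sup_eq_top]
    exact Submodule.mem_top
  obtain ⟨_, ⟨x, rfl⟩, w, hw, h⟩ := Submodule.mem_sup.1 hv
  exact ⟨x, w, hw, h.symm⟩

theorem exists_isCanonicalMap (lam : K →* H)
    (hs : IsCompl (LinearMap.range (inclLie (EG := EG) (EK := EK) K).toLinearMap) s)
    (hinj : Function.Injective (inclLie (EG := EG) (EK := EK) K)) :
    ∃ W : GroupLieAlgebra 𝓘(ℝ, EG) G →ₗ[ℝ] GroupLieAlgebra 𝓘(ℝ, EH) H,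
      IsCanonicalMap EK lam s W := by
  let e := LinearEquiv.ofInjective (inclLie (EG := EG) (EK := EK) K).toLinearMap hinj
  let W := LinearMap.ofIsCompl hs
    ((lieMap (E := EK) (E' := EH) lam).toLinearMap ∘ₗ e.symm.toLinearMap) 0
  refine ⟨W, fun x => ?_, fun v hv => LinearMap.ofIsCompl_apply_right hs ⟨v, hv⟩⟩
  refine (LinearMap.ofIsCompl_apply_left hs (e x)).trans ?_
  exact congrArg (lieMap (E := EK) (E' := EH) lam) (e.symm_apply_apply x)

theorem IsCanonicalMap.ext {W W' : GroupLieAlgebra 𝓘(ℝ, EG) G →ₗ[ℝ] GroupLieAlgebra 𝓘(ℝ, EH) H}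
    (hs : IsCompl (LinearMap.range (inclLie (EG := EG) (EK := EK) K).toLinearMap) s)
    (hW : IsCanonicalMap EK lam s W) (hW' : IsCanonicalMap EK lam s W') : W = W' := by
  ext v
  obtain ⟨x, w, hw, rfl⟩ := exists_eq_add_of_isCompl hs v
  rw [map_add, map_add, hW.1, hW'.1, hW.2 w hw, hW'.2 w hw]

/-- The canonical map of a `lam`-reductive decomposition is equivariant: on `𝔨` because `lam` is a
homomorphism, on `𝔰` because `Ad_k` maps `𝔰` to `ker lam_* ⊕ 𝔰`, where the canonical map is zero. -/
theorem IsCanonicalMap.isWangMap [LieGroup 𝓘(ℝ, EG) ∞ G] [LieGroup 𝓘(ℝ, EH) ∞ H]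
    [LieGroup 𝓘(ℝ, EK) ∞ K] (hK : ContMDiff 𝓘(ℝ, EK) 𝓘(ℝ, EG) ∞ (Subtype.val : K → G))
    (hlam : ContMDiff 𝓘(ℝ, EK) 𝓘(ℝ, EH) ∞ lam)
    {W : GroupLieAlgebra 𝓘(ℝ, EG) G →ₗ[ℝ] GroupLieAlgebra 𝓘(ℝ, EH) H}
    (hs : IsLambdaReductive EK EH lam s) (hW : IsCanonicalMap EK lam s W) :
    IsWangMap EK lam W := by
  refine ⟨hW.1, fun k v => ?_⟩
  obtain ⟨x, w, hw, rfl⟩ := exists_eq_add_of_isCompl hs.isCompl v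
  have h1 : Ad (k : G) (inclLie (EG := EG) (EK := EK) K x) = inclLie K (Ad k x) :=
    (tderiv_modelAd (f := K.subtype) hK k x).symm
  have h2 : lieMap (E := EK) (E' := EH) lam (Ad k x) = Ad (lam k) (lieMap lam x) :=
    tderiv_modelAd hlam k x
  have h3 : W (Ad (k : G) w) = 0 := by
    obtain ⟨_, ⟨y, hy, rfl⟩, w', hw', h⟩ := Submodule.mem_sup.1 (hs.ad_mem k w hw)
    rw [← h, map_add, hW.2 w' hw', add_zero]
    exact (hW.1 y).trans hy
  rw [map_add, map_add, map_add, map_add, h1, hW.1, h2, h3, hW.1, hW.2 w hw, map_zero]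

theorem IsReductive.isLambdaReductive (lam : K →* H) (hs : IsReductive EK K s) :
    IsLambdaReductive EK EH lam s :=
  ⟨hs.isCompl, fun k v hv => sup_le_sup_right (Submodule.map_mono bot_le) s (hs.ad_mem k v hv)⟩

end WangMaps

section ReductiveConnection

variable {EG : Type*} [NormedAddCommGroup EG] [NormedSpace ℝ EG]
  {G : Type*} [TopologicalSpace G] [ChartedSpace EG G] [Group G] [LieGroup 𝓘(ℝ, EG) ∞ G]
  {EK : Type*} [NormedAddCommGroup EK] [NormedSpace ℝ EK]
  {K : Subgroup G} [ChartedSpace EK K] [LieGroup 𝓘(ℝ, EK) ∞ K]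
  {s : Submodule ℝ (GroupLieAlgebra 𝓘(ℝ, EG) G)} {p : EG →L[ℝ] EK}

omit [LieGroup 𝓘(ℝ, EK) ∞ K] in
/-- A linear map `p : 𝔤 → 𝔨` gives the form `p ∘ Θ_G` on `G`. If `p` is a Wang map for the identity
of `K`, it is a connection on `G → G ⧸ K`. -/
theorem isConnection_comp_maurerCartan
    (hK : ContMDiff 𝓘(ℝ, EK) 𝓘(ℝ, EG) ∞ (Subtype.val : K → G))
    (hp : ∀ x : EK, p (tderiv 𝓘(ℝ, EK) 𝓘(ℝ, EG) (Subtype.val : K → G) 1 x) = x)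
    (hpAd : ∀ (k : K) (v : EG), p (modelAd EG (k : G) v) = modelAd EK k (p v)) :
    IsConnection (EH := EK) (H := K) (fun (g : G) (k : K) => g * (k : G))
      ((fun g => p.comp (maurerCartan EG g)) : LieForm EG G EK K) where
  smooth := p.contDiff.contMDiff.comp
    (contMDiff_maurerCartan (I := 𝓘(ℝ, EG).tangent) (M := TangentBundle 𝓘(ℝ, EG) G) contMDiff_id)
  equivariant := by
    intro k g
    change ∀ v : EG, p (maurerCartan EG (g * k) (tderiv 𝓘(ℝ, EG) 𝓘(ℝ, EG)
      (fun x : G => x * k) g v)) = modelAd EK k⁻¹ (p (maurerCartan EG g v))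
    intro v
    rw [maurerCartan_mulRight, ← Subgroup.coe_inv, hpAd]
  fundamental := by
    intro g
    change ∀ y : EK, p (maurerCartan EG (g * (1 : K)) (tderiv 𝓘(ℝ, EK) 𝓘(ℝ, EG)
      (fun k : K => g * (k : G)) 1 y)) = y
    intro y
    have h := tderiv_comp_apply (contMDiff_mulLeft (E := EG) g) hK 1 y
    rw [OneMemClass.coe_one] at h
    rw [← h, OneMemClass.coe_one, mul_one, maurerCartan_mulLeft_one, hp]

omit [LieGroup 𝓘(ℝ, EK) ∞ K] in
theorem isInvariant_comp_maurerCartan :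
    IsInvariant (EH := EK) (H := K) (fun g x : G => g * x)
      ((fun g => p.comp (maurerCartan EG g)) : LieForm EG G EK K) := by
  intro a g
  change ∀ v : EG, p (maurerCartan EG (a * g) (tderiv 𝓘(ℝ, EG) 𝓘(ℝ, EG)
    (fun x : G => a * x) g v)) = p (maurerCartan EG g v)
  intro v
  rw [maurerCartan_mulLeft]

omit [LieGroup 𝓘(ℝ, EK) ∞ K] in
theorem isMaurerCartanProj_comp_maurerCartan
    (hp : ∀ x : EK, p (tderiv 𝓘(ℝ, EK) 𝓘(ℝ, EG) (Subtype.val : K → G) 1 x) = x)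
    (hps : ∀ v ∈ s, p v = 0) :
    IsMaurerCartanProj EK K s ((fun g => p.comp (maurerCartan EG g)) : LieForm EG G EK K) := by
  intro g
  have h1 : ∀ v : EG, p (maurerCartan EG g (tderiv 𝓘(ℝ, EG) 𝓘(ℝ, EG) (fun x : G => g * x) 1 v)) =
      p v := fun v => by rw [maurerCartan_mulLeft_one]
  exact ⟨fun x => (h1 _).trans (hp x), fun v hv => (h1 v).trans (hps v hv)⟩

omit [LieGroup 𝓘(ℝ, EK) ∞ K] in
/-- The form `proj_𝔨 ∘ Θ_G` is unique, because the left-invariant fields span every tangent space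
of `G`. -/
theorem IsMaurerCartanProj.ext
    (hs : IsCompl (LinearMap.range (inclLie (EG := EG) (EK := EK) K).toLinearMap) s)
    {θ θ' : LieForm EG G EK K} (hθ : IsMaurerCartanProj EK K s θ)
    (hθ' : IsMaurerCartanProj EK K s θ') : θ = θ' := by
  funext g
  refine ContinuousLinearMap.ext fun v => ?_
  obtain ⟨x, w, hw, h⟩ := exists_eq_add_of_isCompl hs (maurerCartan EG g v)
  have h1 : v = mulInvariantVectorField (inclLie (EG := EG) (EK := EK) K x) g +
      mulInvariantVectorField w g := by
    refine (mulLeft_maurerCartan (E := EG) g v).symm.trans ?_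
    rw [h]
    exact map_add (tderiv 𝓘(ℝ, EG) 𝓘(ℝ, EG) (fun x : G => g * x) 1) _ _
  rw [h1, map_add, map_add, (hθ g).1, (hθ' g).1, (hθ g).2 w hw, (hθ' g).2 w hw]

end ReductiveConnection

/-! ### The canonical connection -/

section CanonicalConnection

variable {EG : Type*} [NormedAddCommGroup EG] [NormedSpace ℝ EG]
  {G : Type*} [TopologicalSpace G] [ChartedSpace EG G] [Group G] [LieGroup 𝓘(ℝ, EG) ∞ G]
  {EH : Type*} [NormedAddCommGroup EH] [NormedSpace ℝ EH]
  {H : Type*} [TopologicalSpace H] [ChartedSpace EH H] [Group H] [LieGroup 𝓘(ℝ, EH) ∞ H]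
  {EK : Type*} [NormedAddCommGroup EK] [NormedSpace ℝ EK]
  {K : Subgroup G} [ChartedSpace EK K]
  {lam : K →* H}
  {EP : Type*} [NormedAddCommGroup EP] [NormedSpace ℝ EP] [ChartedSpace EP (Bundle lam)]
  [IsManifold 𝓘(ℝ, EP) ∞ (Bundle lam)]

/-- An invariant connection form is determined by its Wang map, because both determine the pullback
to `G × H`. -/
theorem IsConnection.ext_of_isAssociated [FiniteDimensional ℝ EG]
    (hq : IsQuotientManifold EG EH lam EP)
    {W : GroupLieAlgebra 𝓘(ℝ, EG) G →ₗ[ℝ] GroupLieAlgebra 𝓘(ℝ, EH) H}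
    {η η' : LieForm EP (Bundle lam) EH H}
    (hη : IsConnection (Bundle.right lam) η) (hi : IsInvariant (Bundle.left lam) η)
    (ha : IsAssociated lam W η)
    (hη' : IsConnection (Bundle.right lam) η') (hi' : IsInvariant (Bundle.left lam) η')
    (ha' : IsAssociated lam W η') : η = η' := by
  let W' : EG →L[ℝ] EH := LinearMap.toContinuousLinearMap (W : EG →ₗ[ℝ] EH)
  exact form_ext_of_pullback (EG := EG) hq fun a u =>
    (pullback_eq_wangForm (W := W') hq hη (pullback_section_of_isInvariant hq hi ha) a u).trans
      (pullback_eq_wangForm (W := W') hq hη' (pullback_section_of_isInvariant hq hi' ha') a u).symm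

/-- The existence half of Wang's theorem. -/
theorem IsWangMap.exists_isConnection [FiniteDimensional ℝ EG] [FiniteDimensional ℝ EH]
    [FiniteDimensional ℝ EK] [FiniteDimensional ℝ EP] [LieGroup 𝓘(ℝ, EK) ∞ K]
    (hdim : Module.finrank ℝ EP + Module.finrank ℝ EK = Module.finrank ℝ EG + Module.finrank ℝ EH)
    (hK : ContMDiff 𝓘(ℝ, EK) 𝓘(ℝ, EG) ∞ (Subtype.val : K → G))
    (hinj : Function.Injective (inclLie (EG := EG) (EK := EK) K))
    (hlam : ContMDiff 𝓘(ℝ, EK) 𝓘(ℝ, EH) ∞ lam)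
    (hq : IsQuotientManifold EG EH lam EP)
    {W : GroupLieAlgebra 𝓘(ℝ, EG) G →ₗ[ℝ] GroupLieAlgebra 𝓘(ℝ, EH) H}
    (hW : IsWangMap EK lam W) :
    ∃ η : LieForm EP (Bundle lam) EH H, IsConnection (Bundle.right lam) η ∧
      IsInvariant (Bundle.left lam) η ∧ IsAssociated lam W η := by
  let W' : EG →L[ℝ] EH := LinearMap.toContinuousLinearMap (W : EG →ₗ[ℝ] EH)
  obtain ⟨η, hη, hsm⟩ := exists_form_of_isWangMap (W := W') hdim hq hK hinj hlam hW.eq_on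
    hW.equivariant
  refine ⟨η, isConnection_of_pullback_eq_wangForm hq hη hsm,
    isInvariant_of_pullback_eq_wangForm hq hη, ?_⟩
  change ∀ x : EG, η (Bundle.mk lam (1 * 1, 1)) (tderiv 𝓘(ℝ, EG) 𝓘(ℝ, EP)
    (fun g => Bundle.mk lam (g * 1, 1)) 1 x) = W' x
  intro x
  simp only [mul_one]
  rw [pullback_section_of_pullback_eq_wangForm hq.contMDiff hη, maurerCartan_one]

/-- A connection form induced by `p ∘ Θ_G` and an invariant connection form with Wang map
`lam_* ∘ p` have the same pullback along `g ↦ [g, 1]`, and so are equal. -/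
theorem isInduced_and_unique [FiniteDimensional ℝ EG]
    (hq : IsQuotientManifold EG EH lam EP) {p : EG →L[ℝ] EK}
    {W : GroupLieAlgebra 𝓘(ℝ, EG) G →ₗ[ℝ] GroupLieAlgebra 𝓘(ℝ, EH) H}
    (hpW : ∀ v : EG, W v = lieMap (E := EK) (E' := EH) lam (p v))
    {η : LieForm EP (Bundle lam) EH H}
    (hη : IsConnection (Bundle.right lam) η) (hi : IsInvariant (Bundle.left lam) η)
    (ha : IsAssociated lam W η) :
    IsInduced lam ((fun g => p.comp (maurerCartan EG g)) : LieForm EG G EK K) η ∧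
    ∀ η' : LieForm EP (Bundle lam) EH H, IsConnection (Bundle.right lam) η' →
      IsInduced lam ((fun g => p.comp (maurerCartan EG g)) : LieForm EG G EK K) η' → η' = η := by
  let W' : EG →L[ℝ] EH := LinearMap.toContinuousLinearMap (W : EG →ₗ[ℝ] EH)
  have h := pullback_section_of_isInvariant (W := W') hq hi ha
  refine ⟨fun g v => (h g v).trans (hpW _), fun η' hη' hind => ?_⟩
  exact form_ext_of_pullback (EG := EG) hq fun a u =>
    (pullback_eq_wangForm (W := W') hq hη'
      (fun g v => (hind g v).trans (hpW (maurerCartan EG g v)).symm) a u).trans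
      (pullback_eq_wangForm (W := W') hq hη h a u).symm

end CanonicalConnection

end HomogeneousBundle

end

theorem mainTheorem5
    {EG : Type*} [NormedAddCommGroup EG] [NormedSpace ℝ EG] [FiniteDimensional ℝ EG]
    {G : Type*} [TopologicalSpace G] [ChartedSpace EG G] [Group G] [LieGroup 𝓘(ℝ, EG) ∞ G]
    {EH : Type*} [NormedAddCommGroup EH] [NormedSpace ℝ EH] [FiniteDimensional ℝ EH]
    {H : Type*} [TopologicalSpace H] [ChartedSpace EH H] [Group H] [LieGroup 𝓘(ℝ, EH) ∞ H]
    {EK : Type*} [NormedAddCommGroup EK] [NormedSpace ℝ EK] [FiniteDimensional ℝ EK]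
    (K : Subgroup G) [ChartedSpace EK K] [LieGroup 𝓘(ℝ, EK) ∞ K]
    (hKclosed : IsClosed (K : Set G))
    (hK : Manifold.IsSmoothEmbedding 𝓘(ℝ, EK) 𝓘(ℝ, EG) ∞ (Subtype.val : K → G))
    (lam : K →* H) (hlam : ContMDiff 𝓘(ℝ, EK) 𝓘(ℝ, EH) ∞ lam)
    (s : Submodule ℝ (GroupLieAlgebra 𝓘(ℝ, EG) G)) :
    -- the quotient manifold `P_lam = G ×_lam H` exists
    (∃ (_ : ChartedSpace (HomogeneousBundle.Model EG EK EH) (HomogeneousBundle.Bundle lam))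
        (_ : IsManifold 𝓘(ℝ, HomogeneousBundle.Model EG EK EH) ∞ (HomogeneousBundle.Bundle lam)),
      HomogeneousBundle.IsQuotientManifold EG EH lam (HomogeneousBundle.Model EG EK EH)) ∧
    ∀ [ChartedSpace (HomogeneousBundle.Model EG EK EH) (HomogeneousBundle.Bundle lam)]
      [IsManifold 𝓘(ℝ, HomogeneousBundle.Model EG EK EH) ∞ (HomogeneousBundle.Bundle lam)],
      HomogeneousBundle.IsQuotientManifold EG EH lam (HomogeneousBundle.Model EG EK EH) →
      -- the canonical invariant connection of a `lam`-reductive decomposition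
      (HomogeneousBundle.IsLambdaReductive EK EH lam s →
        ∃ W : GroupLieAlgebra 𝓘(ℝ, EG) G →ₗ[ℝ] GroupLieAlgebra 𝓘(ℝ, EH) H,
          HomogeneousBundle.IsCanonicalMap EK lam s W ∧
          (∀ W', HomogeneousBundle.IsCanonicalMap EK lam s W' → W' = W) ∧
          HomogeneousBundle.IsWangMap EK lam W ∧
          ∃! η : HomogeneousBundle.LieForm (HomogeneousBundle.Model EG EK EH)
              (HomogeneousBundle.Bundle lam) EH H,
            HomogeneousBundle.IsConnection (HomogeneousBundle.Bundle.right lam) η ∧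
            HomogeneousBundle.IsInvariant (HomogeneousBundle.Bundle.left lam) η ∧
            HomogeneousBundle.IsAssociated lam W η) ∧
      -- the reductive case
      (HomogeneousBundle.IsReductive EK K s →
        HomogeneousBundle.IsLambdaReductive EK EH lam s ∧
        ∃ θ : HomogeneousBundle.LieForm EG G EK K,
          HomogeneousBundle.IsMaurerCartanProj EK K s θ ∧
          (∀ θ', HomogeneousBundle.IsMaurerCartanProj EK K s θ' → θ' = θ) ∧
          HomogeneousBundle.IsConnection (fun (g : G) (k : K) => g * (k : G)) θ ∧
          HomogeneousBundle.IsInvariant (fun g x : G => g * x) θ ∧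
          ∀ (W : GroupLieAlgebra 𝓘(ℝ, EG) G →ₗ[ℝ] GroupLieAlgebra 𝓘(ℝ, EH) H)
            (η : HomogeneousBundle.LieForm (HomogeneousBundle.Model EG EK EH)
              (HomogeneousBundle.Bundle lam) EH H),
            HomogeneousBundle.IsCanonicalMap EK lam s W →
            HomogeneousBundle.IsConnection (HomogeneousBundle.Bundle.right lam) η →
            HomogeneousBundle.IsInvariant (HomogeneousBundle.Bundle.left lam) η →
            HomogeneousBundle.IsAssociated lam W η →
            HomogeneousBundle.IsInduced lam θ η ∧
            ∀ η' : HomogeneousBundle.LieForm (HomogeneousBundle.Model EG EK EH)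
                (HomogeneousBundle.Bundle lam) EH H,
              HomogeneousBundle.IsConnection (HomogeneousBundle.Bundle.right lam) η' →
              HomogeneousBundle.IsInduced lam θ η' → η' = η) := by
  have hKs : ContMDiff 𝓘(ℝ, EK) 𝓘(ℝ, EG) ∞ (Subtype.val : K → G) := hK.isImmersion.contMDiff
  have hinj : Function.Injective (HomogeneousBundle.inclLie (EG := EG) (EK := EK) K) :=
    HomogeneousBundle.mfderiv_injective_of_isImmersionAtOfComplement
      (hK.isImmersion.isImmersionOfComplement_complement 1)
  have hle : Module.finrank ℝ EK ≤ Module.finrank ℝ EG :=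
    LinearMap.finrank_le_finrank_of_injective (M := EK) (M' := EG)
      (f := (HomogeneousBundle.inclLie (EG := EG) (EK := EK) K).toLinearMap) hinj
  have hdim : Module.finrank ℝ (HomogeneousBundle.Model EG EK EH) + Module.finrank ℝ EK =
      Module.finrank ℝ EG + Module.finrank ℝ EH := by
    rw [finrank_euclideanSpace_fin]
    omega
  refine ⟨HomogeneousBundle.exists_isQuotientManifold hK.isImmersion lam hlam, ?_⟩
  intro _ _ hq
  refine ⟨fun hs => ?_, fun hs => ?_⟩
  · obtain ⟨W, hW⟩ :=
      HomogeneousBundle.exists_isCanonicalMap (EH := EH) lam hs.isCompl hinj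
    have hWang := hW.isWangMap hKs hlam hs
    obtain ⟨η, hη, hi, ha⟩ := hWang.exists_isConnection hdim hKs hinj hlam hq
    exact ⟨W, hW, fun W' hW' => hW'.ext hs.isCompl hW, hWang, η, ⟨hη, hi, ha⟩,
      fun η' h => h.1.ext_of_isAssociated hq h.2.1 h.2.2 hη hi ha⟩
  · -- The projection `𝔤 → 𝔨` along `𝔰` is the canonical map of the identity of `K`.
    obtain ⟨p, hp⟩ :=
      HomogeneousBundle.exists_isCanonicalMap (EH := EK) (MonoidHom.id K) hs.isCompl hinj
    have hpWang := hp.isWangMap hKs contMDiff_id (hs.isLambdaReductive (MonoidHom.id K))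
    have hpK : ∀ x : EK, p (HomogeneousBundle.inclLie (EG := EG) (EK := EK) K x) = x :=
      fun x => (hp.1 x).trans (HomogeneousBundle.tderiv_id_apply (I := 𝓘(ℝ, EK)) (1 : K) x)
    let p' : EG →L[ℝ] EK := LinearMap.toContinuousLinearMap (p : EG →ₗ[ℝ] EK)
    have hproj := HomogeneousBundle.isMaurerCartanProj_comp_maurerCartan (p := p') hpK hp.2
    refine ⟨hs.isLambdaReductive lam, _, hproj, fun θ' hθ' => hθ'.ext hs.isCompl hproj,
      HomogeneousBundle.isConnection_comp_maurerCartan hKs hpK hpWang.equivariant,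
      HomogeneousBundle.isInvariant_comp_maurerCartan, fun W η hW hη hi ha => ?_⟩
    refine HomogeneousBundle.isInduced_and_unique hq (fun v => ?_) hη hi ha
    obtain ⟨x, w, hw, rfl⟩ := HomogeneousBundle.exists_eq_add_of_isCompl hs.isCompl v
    rw [map_add, hW.1, hW.2 w hw, add_zero]
    have h : p (HomogeneousBundle.inclLie (EG := EG) (EK := EK) K x + w) = x := by
      rw [map_add, hp.2 w hw, add_zero]
      exact hpK x
    exact congrArg (HomogeneousBundle.lieMap (E := EK) (E' := EH) lam) h.symm
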